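/- Let $X$ be a locally finite connected graph (regarded as a topological space, i.e. a connected $1$-dimensional CW complex in which every vertex lies on finitely many edges). An \emph{immersed loop} in $X$ is a locally injective continuous map $S^1\to X$, and the \emph{core} $X_g\subseteq X$ is the smallest subgraph of $X$ containing all immersed loops; $X$ is a \emph{core graph} if $X=X_g$. Two maps $f,g\colon X\to X$ are \emph{properly homotopic} if there is a homotopy $X\times[0,1]\to X$ from $f$ to $g$ that is a proper map. A \emph{proper homotopy equivalence} of $X$ is a proper map $f\colon X\to X$ for which there is a proper map $g\colon X\to X$ with $fg$ and $gf$ properly homotopic to the identity; $\mathrm{Maps}(X)$ is the group of proper homotopy equivalences of $X$ up to proper homotopy, under composition. For a basepoint $x_0\in X$, a map $f\colon X\to X$ induces an endomorphism $f_*$ of $\pi_1(X,x_0)$ (by transporting the basepoint along a path from $x_0$ to $f(x_0)$), well defined up to inner automorphisms; $f_*=\mathrm{id}\in\mathrm{Out}(\pi_1(X))$ means that $f_*$ is an inner automorphism. Let $\Psi\colon \mathrm{Maps}(X)\to\mathrm{Out}(\pi_1(X,x_0))$ be the homomorphism sending the class of $h$ to the outer automorphism class of $h_*$. Suppose that $X$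 is a core graph. If $f\colon X\to X$ is a proper map with $f_*=\mathrm{id}\in\mathrm{Out}(\pi_1(X))$, then $f$ is properly homotopic to the identity on $X$. In particular, $\Psi$ is injective. -/

import Mathlib

open Set CategoryTheory
open scoped unitInterval

/-! ## Graphs, immersed loops and the core -/

/-- `X` is a locally finite connected graph: a Hausdorff space with a CW structure without cells
of dimension at least two, connected, in which every vertex lies on only finitely many edges. -/
class LocallyFiniteConnectedGraph (X : Type*) [TopologicalSpace X]
    [Topology.CWComplex (univ : Set X)] : Prop extends T2Space X, ConnectedSpace X where
  isEmpty_cell : ∀ n : ℕ, 2 ≤ n → IsEmpty (Topology.RelCWComplex.cell (univ : Set X) n)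
  finite_edges : ∀ v : Topology.RelCWComplex.cell (univ : Set X) 0,
    {e : Topology.RelCWComplex.cell (univ : Set X) 1 |
      Topology.RelCWComplex.closedCell 0 v ⊆ Topology.RelCWComplex.closedCell 1 e}.Finite

/-- An immersed loop: a locally injective continuous map from the circle. -/
def IsImmersedLoop {X : Type*} [TopologicalSpace X] (γ : C(Circle, X)) : Prop :=
  IsLocallyInjective γ

/-- The core `X_g`: the smallest subgraph containing (the images of) all immersed loops. -/
def graphCore (X : Type*) [TopologicalSpace X] [Topology.CWComplex (univ : Set X)] : Set X :=
  ⋂ (Y : Topology.CWComplex.Subcomplex (univ : Set X))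
    (_ : ∀ γ : C(Circle, X), IsImmersedLoop γ → range γ ⊆ (Y : Set X)), (Y : Set X)

/-- `X` is a core graph if `X = X_g`. -/
def IsCoreGraph (X : Type*) [TopologicalSpace X] [Topology.CWComplex (univ : Set X)] : Prop :=
  graphCore X = univ

/-- A connected CW complex is path connected. -/
theorem pathConnectedSpace_of_cwComplex (X : Type*) [TopologicalSpace X]
    [Topology.CWComplex (univ : Set X)] [T2Space X] [ConnectedSpace X] :
    PathConnectedSpace X := by
  have hcell : ∀ (n : ℕ) (j : Topology.RelCWComplex.cell (univ : Set X) n),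
      IsPathConnected (Topology.RelCWComplex.closedCell n j) := by
    intro n j
    refine IsPathConnected.image' ?_ (Topology.CWComplex.continuousOn n j)
    exact (convex_closedBall (0 : Fin n → ℝ) 1).isPathConnected
      (Metric.nonempty_closedBall.2 zero_le_one)
  have hclosed : ∀ A : Set X, (∀ a ∈ A, ∀ b, Joined a b → b ∈ A) → IsClosed A := by
    intro A hA
    refine Topology.CWComplex.closed' A (subset_univ (A : Set X))
      (fun n (j : Topology.RelCWComplex.cell (univ : Set X) n) => ?_)
    rcases (A ∩ Topology.RelCWComplex.closedCell n j).eq_empty_or_nonempty with h | ⟨a, haA, haj⟩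
    · change IsClosed (A ∩ Topology.RelCWComplex.closedCell n j)
      rw [h]
      exact isClosed_empty
    · change IsClosed (A ∩ Topology.RelCWComplex.closedCell n j)
      rw [inter_eq_right.2 fun b hb => hA a haA b ((hcell n j).joinedIn a haj b hb).joined]
      exact Topology.CWComplex.isClosed_closedCell
  obtain ⟨x⟩ := (inferInstance : Nonempty X)
  refine ⟨⟨x⟩, fun a b => ?_⟩
  have hclopen : IsClopen (pathComponent a) := by
    refine ⟨hclosed _ fun c hc d hcd => ?_, ?_⟩
    · exact Joined.trans hc hcd
    · rw [← isClosed_compl_iff]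
      refine hclosed _ fun c hc d hcd hd => hc ?_
      exact Joined.trans (y := d) hd hcd.symm
  have hu := hclopen.eq_univ ⟨a, mem_pathComponent_self a⟩
  have hb : b ∈ pathComponent a := hu ▸ mem_univ b
  exact hb

instance (X : Type*) [TopologicalSpace X] [Topology.CWComplex (univ : Set X)]
    [LocallyFiniteConnectedGraph X] : PathConnectedSpace X :=
  pathConnectedSpace_of_cwComplex X

/-! ## Proper homotopy -/

section ProperHomotopy

variable {X Y Z : Type*} [TopologicalSpace X] [TopologicalSpace Y] [TopologicalSpace Z]

/-- `f` and `g` are properly homotopic: there is a homotopy `I × X → Y` from `f` to `g` which is a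
proper map. -/
def ProperlyHomotopic (f g : C(X, Y)) : Prop :=
  ∃ H : f.Homotopy g, IsProperMap (H : I × X → Y)

theorem ProperlyHomotopic.refl {f : C(X, Y)} (hf : IsProperMap f) : ProperlyHomotopic f f :=
  ⟨.refl f, hf.comp isProperMap_snd_of_compactSpace⟩

theorem ProperlyHomotopic.symm {f g : C(X, Y)} (h : ProperlyHomotopic f g) :
    ProperlyHomotopic g f := by
  obtain ⟨H, hH⟩ := h
  refine ⟨H.symm, ?_⟩
  have hs : IsProperMap (unitInterval.symm : I → I) := unitInterval.continuous_symm.isProperMap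
  exact hH.comp (hs.prodMap isProperMap_id)

theorem ProperlyHomotopic.trans {f g h : C(X, Y)} (h₁ : ProperlyHomotopic f g)
    (h₂ : ProperlyHomotopic g h) : ProperlyHomotopic f h := by
  obtain ⟨F, hF⟩ := h₁
  obtain ⟨G, hG⟩ := h₂
  refine ⟨F.trans G, ?_⟩
  let a : I → I := fun t => projIcc (0 : ℝ) 1 zero_le_one (2 * (t : ℝ))
  let b : I → I := fun t => projIcc (0 : ℝ) 1 zero_le_one (2 * (t : ℝ) - 1)
  have ha : IsProperMap a := Continuous.isProperMap (continuous_projIcc.comp (by fun_prop))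
  have hb : IsProperMap b := Continuous.isProperMap (continuous_projIcc.comp (by fun_prop))
  have hFa := hF.comp (ha.prodMap (isProperMap_id (X := X)))
  have hGb := hG.comp (hb.prodMap (isProperMap_id (X := X)))
  have eF : ∀ p : I × X, (p.1 : ℝ) ≤ 1 / 2 → F.trans G p = F (a p.1, p.2) := by
    intro p hp
    rw [ContinuousMap.Homotopy.trans_apply, dif_pos hp]
    congr 2
    exact (projIcc_of_mem zero_le_one _).symm
  have eG : ∀ p : I × X, (1 : ℝ) / 2 ≤ p.1 → F.trans G p = G (b p.1, p.2) := by
    intro p hp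
    rcases hp.eq_or_lt with h | h
    · rw [eF p h.ge]
      have e1 : a p.1 = 1 := projIcc_of_right_le zero_le_one (by rw [← h]; norm_num)
      have e2 : b p.1 = 0 := projIcc_of_le_left zero_le_one (by rw [← h]; norm_num)
      rw [e1, e2]
      simp
    · rw [ContinuousMap.Homotopy.trans_apply, dif_neg h.not_ge]
      congr 2
      exact (projIcc_of_mem zero_le_one _).symm
  rw [isProperMap_iff_ultrafilter]
  refine ⟨(F.trans G).continuous_toFun, fun 𝒰 y hy => ?_⟩
  rcases 𝒰.mem_or_compl_mem {p : I × X | (p.1 : ℝ) ≤ 1 / 2} with hA | hA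
  · have hc : IsClosed {p : I × X | (p.1 : ℝ) ≤ 1 / 2} :=
      isClosed_le (by fun_prop) continuous_const
    have hy' : Filter.Tendsto (fun p : I × X => F (a p.1, p.2)) 𝒰 (nhds y) :=
      hy.congr' (Filter.mem_of_superset hA fun p hp => eF p hp)
    obtain ⟨x, hx, hle⟩ := (isProperMap_iff_ultrafilter.1 hFa).2 hy'
    refine ⟨x, ?_, hle⟩
    have hxA : x ∈ {p : I × X | (p.1 : ℝ) ≤ 1 / 2} := hc.mem_of_tendsto hle hA
    rw [eF x hxA]
    exact hx
  · have hA' : {p : I × X | (1 : ℝ) / 2 ≤ p.1} ∈ 𝒰 :=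
      Filter.mem_of_superset hA fun p (hp : ¬ (p.1 : ℝ) ≤ 1 / 2) => (not_le.1 hp).le
    have hc : IsClosed {p : I × X | (1 : ℝ) / 2 ≤ p.1} :=
      isClosed_le continuous_const (by fun_prop)
    have hy' : Filter.Tendsto (fun p : I × X => G (b p.1, p.2)) 𝒰 (nhds y) :=
      hy.congr' (Filter.mem_of_superset hA' fun p hp => eG p hp)
    obtain ⟨x, hx, hle⟩ := (isProperMap_iff_ultrafilter.1 hGb).2 hy'
    refine ⟨x, ?_, hle⟩
    have hxA : x ∈ {p : I × X | (1 : ℝ) / 2 ≤ p.1} := hc.mem_of_tendsto hle hA'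
    rw [eG x hxA]
    exact hx

theorem ProperlyHomotopic.comp_left {f g : C(X, Y)} {k : C(Y, Z)} (hk : IsProperMap k)
    (h : ProperlyHomotopic f g) : ProperlyHomotopic (k.comp f) (k.comp g) := by
  obtain ⟨H, hH⟩ := h
  exact ⟨(ContinuousMap.Homotopy.refl k).comp H, hk.comp hH⟩

theorem ProperlyHomotopic.comp_right {f g : C(Y, Z)} {k : C(X, Y)} (hk : IsProperMap k)
    (h : ProperlyHomotopic f g) : ProperlyHomotopic (f.comp k) (g.comp k) := by
  obtain ⟨H, hH⟩ := h
  exact ⟨H.compContinuousMap k, hH.comp (isProperMap_id.prodMap hk)⟩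

/-- `f` is a proper homotopy equivalence of `X`: it is proper and there is a proper map `g` such
that `f ∘ g` and `g ∘ f` are properly homotopic to the identity. -/
def IsProperHomotopyEquiv (f : C(X, X)) : Prop :=
  IsProperMap f ∧ ∃ g : C(X, X), IsProperMap g ∧
    ProperlyHomotopic (f.comp g) (ContinuousMap.id X) ∧
    ProperlyHomotopic (g.comp f) (ContinuousMap.id X)

theorem IsProperHomotopyEquiv.id : IsProperHomotopyEquiv (ContinuousMap.id X) :=
  ⟨isProperMap_id, ContinuousMap.id X, isProperMap_id, .refl isProperMap_id, .refl isProperMap_id⟩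

theorem IsProperHomotopyEquiv.comp {f f' : C(X, X)} (hf : IsProperHomotopyEquiv f)
    (hf' : IsProperHomotopyEquiv f') : IsProperHomotopyEquiv (f.comp f') := by
  obtain ⟨pf, g, pg, h1, h2⟩ := hf
  obtain ⟨pf', g', pg', h1', h2'⟩ := hf'
  refine ⟨pf.comp pf', g'.comp g, pg'.comp pg, ?_, ?_⟩
  · exact ((h1'.comp_right pg).comp_left pf).trans h1
  · exact ((h2.comp_right pf').comp_left pg').trans h2'

end ProperHomotopy

/-! ## The mapping class group `Maps(X)` -/

section Maps

variable (X : Type*) [TopologicalSpace X]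

/-- Proper homotopy equivalences of `X`. -/
abbrev ProperHomotopyEquivs : Type _ := {f : C(X, X) // IsProperHomotopyEquiv f}

/-- Proper homotopy as an equivalence relation on proper homotopy equivalences. -/
instance properHomotopySetoid : Setoid (ProperHomotopyEquivs X) where
  r f g := ProperlyHomotopic f.1 g.1
  iseqv := ⟨fun f => .refl f.2.1, fun h => h.symm, fun h h' => h.trans h'⟩

/-- The mapping class group `Maps(X)`: proper homotopy equivalences up to proper homotopy. -/
def Maps : Type _ := Quotient (properHomotopySetoid X)

variable {X}

/-- A proper homotopy inverse. -/
noncomputable def ProperHomotopyEquivs.inverse (f : ProperHomotopyEquivs X) :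
    ProperHomotopyEquivs X :=
  ⟨f.2.2.choose, f.2.2.choose_spec.1, f.1, f.2.1, f.2.2.choose_spec.2.2, f.2.2.choose_spec.2.1⟩

theorem ProperHomotopyEquivs.comp_inverse (f : ProperHomotopyEquivs X) :
    ProperlyHomotopic (f.1.comp f.inverse.1) (ContinuousMap.id X) :=
  f.2.2.choose_spec.2.1

theorem ProperHomotopyEquivs.inverse_comp (f : ProperHomotopyEquivs X) :
    ProperlyHomotopic (f.inverse.1.comp f.1) (ContinuousMap.id X) :=
  f.2.2.choose_spec.2.2

/-- The group structure on `Maps(X)` is induced by composition. -/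
noncomputable instance : Group (Maps X) :=
  letI : Mul (Maps X) := ⟨Quotient.map₂ (fun f g => ⟨f.1.comp g.1, f.2.comp g.2⟩)
    fun f f' hf g g' hg => (ProperlyHomotopic.comp_right g.2.1 hf).trans
      (ProperlyHomotopic.comp_left f'.2.1 hg)⟩
  letI : One (Maps X) := ⟨Quotient.mk _ ⟨ContinuousMap.id X, .id⟩⟩
  letI : Inv (Maps X) := ⟨Quotient.map ProperHomotopyEquivs.inverse fun f f' h =>
    ((f'.comp_inverse.comp_left f.inverse.2.1).symm.trans
      ((ProperlyHomotopic.comp_right f'.inverse.2.1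
        (ProperlyHomotopic.comp_left f.inverse.2.1 h)).symm.trans
        (f.inverse_comp.comp_right f'.inverse.2.1)))⟩
  Group.ofLeftAxioms
    (by rintro ⟨f⟩ ⟨g⟩ ⟨h⟩; rfl)
    (by rintro ⟨f⟩; rfl)
    (by rintro ⟨f⟩; exact Quotient.sound f.inverse_comp)

/-- The mapping class of a proper homotopy equivalence. -/
def Maps.mk (f : ProperHomotopyEquivs X) : Maps X := Quotient.mk _ f

theorem Maps.mk_mul (f g : ProperHomotopyEquivs X) :
    Maps.mk f * Maps.mk g = Maps.mk ⟨f.1.comp g.1, f.2.comp g.2⟩ := rfl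

end Maps

/-! ## Outer automorphisms and the action on the fundamental group -/

/-- The inner automorphisms form a normal subgroup of `Aut(G)`. -/
instance (G : Type*) [Group G] : (MulAut.conj (G := G)).range.Normal where
  conj_mem := by
    rintro _ ⟨g, rfl⟩ φ
    refine ⟨φ g, ?_⟩
    ext x
    simp [MulAut.conj_apply]

/-- The outer automorphism group `Out(G) = Aut(G) / Inn(G)`. -/
abbrev Out (G : Type*) [Group G] : Type _ := MulAut G ⧸ (MulAut.conj (G := G)).range

section Induced

variable {X : Type*} [TopologicalSpace X]

/-- The endomorphism `γ ↦ p · f(γ) · p⁻¹` of `π₁(X, x)` given by a map `f : X → X` and a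
path `p` from `x` to `f x`. -/
noncomputable def endAlong (f : C(X, X)) {x : X} (p : Path x (f x)) :
    FundamentalGroup X x →* FundamentalGroup X x :=
  (FundamentalGroup.fundamentalGroupMulEquivOfPath p).symm.toMonoidHom.comp
    (FundamentalGroup.map f x)

theorem endAlong_apply (f : C(X, X)) {x : X} (p : Path x (f x)) (γ : FundamentalGroup X x) :
    endAlong f p γ = (show FundamentalGroupoid.mk x ⟶ (FundamentalGroupoid.map f).obj ⟨x⟩ from ⟦p⟧)
      ≫ (FundamentalGroupoid.map f).map (X := ⟨x⟩) (Y := ⟨x⟩) γ ≫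
      Groupoid.inv (show FundamentalGroupoid.mk x ⟶ (FundamentalGroupoid.map f).obj ⟨x⟩ from ⟦p⟧) :=
  rfl

/-- Up to inner automorphisms, `endAlong` depends neither on the path nor on `f` within its
homotopy class. -/
theorem endAlong_of_homotopy {f g : C(X, X)} (F : f.Homotopy g) {x : X} (p : Path x (f x))
    (q : Path x (g x)) :
    ∃ c : FundamentalGroup X x,
      endAlong g q = (MulAut.conj c).toMonoidHom.comp (endAlong f p) := by
  let a : FundamentalGroupoid.mk x ⟶ (FundamentalGroupoid.map f).obj ⟨x⟩ := ⟦p⟧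
  let b : FundamentalGroupoid.mk x ⟶ (FundamentalGroupoid.map g).obj ⟨x⟩ := ⟦q⟧
  let η := FundamentalGroupoidFunctor.homotopicMapsNatIso F
  refine ⟨a ≫ η.app ⟨x⟩ ≫ Groupoid.inv b, ?_⟩
  ext γ
  have hn := η.naturality (X := ⟨x⟩) (Y := ⟨x⟩) γ
  change b ≫ (FundamentalGroupoid.map g).map (X := ⟨x⟩) (Y := ⟨x⟩) γ ≫ Groupoid.inv b =
    Groupoid.inv (a ≫ η.app ⟨x⟩ ≫ Groupoid.inv b) ≫
    (a ≫ (FundamentalGroupoid.map f).map (X := ⟨x⟩) (Y := ⟨x⟩) γ ≫ Groupoid.inv a) ≫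
    (a ≫ η.app ⟨x⟩ ≫ Groupoid.inv b)
  generalize (FundamentalGroupoid.map f).map (X := ⟨x⟩) (Y := ⟨x⟩) γ = u at hn ⊢
  generalize (FundamentalGroupoid.map g).map (X := ⟨x⟩) (Y := ⟨x⟩) γ = v at hn ⊢
  simp only [Groupoid.inv_eq_inv, IsIso.inv_comp, IsIso.inv_inv, Category.assoc,
    IsIso.inv_hom_id_assoc]
  rw [reassoc_of% hn]
  simp

theorem endAlong_id {x : X} :
    endAlong (ContinuousMap.id X) (show Path x (ContinuousMap.id X x) from Path.refl x) =
      MonoidHom.id (FundamentalGroup X x) := by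
  ext γ
  have h : Path.Homotopic.Quotient.map γ (ContinuousMap.id X) = γ := by
    obtain ⟨p, rfl⟩ := Path.Homotopic.Quotient.mk_surjective γ
    rfl
  change 𝟙 (FundamentalGroupoid.mk x) ≫ (show FundamentalGroupoid.mk x ⟶ FundamentalGroupoid.mk x
    from Path.Homotopic.Quotient.map γ (ContinuousMap.id X)) ≫
      Groupoid.inv (𝟙 (FundamentalGroupoid.mk x)) = γ
  rw [h, Groupoid.inv_eq_inv, IsIso.inv_id, Category.comp_id,
    Category.id_comp]

theorem endAlong_comp (f g : C(X, X)) {x : X} (p : Path x (f x)) (q : Path x (g x)) :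
    endAlong (f.comp g) (p.trans (q.map f.continuous)) = (endAlong f p).comp (endAlong g q) := by
  ext γ
  let a : FundamentalGroupoid.mk x ⟶ (FundamentalGroupoid.map f).obj ⟨x⟩ := ⟦p⟧
  let b : FundamentalGroupoid.mk x ⟶ (FundamentalGroupoid.map g).obj ⟨x⟩ := ⟦q⟧
  let c : (FundamentalGroupoid.map g).obj ⟨x⟩ ⟶ (FundamentalGroupoid.map g).obj ⟨x⟩ :=
    (FundamentalGroupoid.map g).map (X := ⟨x⟩) (Y := ⟨x⟩) γ
  have h : (FundamentalGroupoid.map (f.comp g)).map (X := ⟨x⟩) (Y := ⟨x⟩) γ =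
      (FundamentalGroupoid.map f).map c := Path.Homotopic.Quotient.map_comp ..
  change (a ≫ (FundamentalGroupoid.map f).map b) ≫
    (show (FundamentalGroupoid.map f).obj ((FundamentalGroupoid.map g).obj ⟨x⟩) ⟶
        (FundamentalGroupoid.map f).obj ((FundamentalGroupoid.map g).obj ⟨x⟩) from
      (FundamentalGroupoid.map (f.comp g)).map (X := ⟨x⟩) (Y := ⟨x⟩) γ) ≫
      Groupoid.inv (a ≫ (FundamentalGroupoid.map f).map b) =
    a ≫ (FundamentalGroupoid.map f).map (b ≫ c ≫ Groupoid.inv b) ≫ Groupoid.inv a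
  rw [h, Functor.map_comp, Functor.map_comp, Groupoid.inv_eq_inv, Groupoid.inv_eq_inv,
    Groupoid.inv_eq_inv, Functor.map_inv, IsIso.inv_comp]
  simp only [Category.assoc]

variable [PathConnectedSpace X]

/-- The endomorphism of `π₁(X, x)` induced by `f : X → X`, transported back to `x` along a chosen
path from `x` to `f x`; up to inner automorphisms the path does not matter. -/
noncomputable def inducedEnd (x : X) (f : C(X, X)) :
    FundamentalGroup X x →* FundamentalGroup X x :=
  endAlong f (PathConnectedSpace.somePath x (f x))

/-- `f_* = id` in `Out(π₁(X, x))`: the endomorphism induced by `f` is an inner automorphism. -/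
def InducesIdentityInOut (x : X) (f : C(X, X)) : Prop :=
  ∃ c : FundamentalGroup X x, inducedEnd x f = (MulAut.conj c).toMonoidHom

theorem inducedEnd_of_homotopy (x : X) {f g : C(X, X)} (F : f.Homotopy g) :
    ∃ c : FundamentalGroup X x,
      inducedEnd x g = (MulAut.conj c).toMonoidHom.comp (inducedEnd x f) :=
  endAlong_of_homotopy F _ _

theorem inducedEnd_id (x : X) :
    ∃ c : FundamentalGroup X x,
      inducedEnd x (ContinuousMap.id X) = (MulAut.conj c).toMonoidHom := by
  obtain ⟨c, hc⟩ := endAlong_of_homotopy (.refl (ContinuousMap.id X))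
    (show Path x (ContinuousMap.id X x) from Path.refl x)
    (PathConnectedSpace.somePath x (ContinuousMap.id X x))
  exact ⟨c, by rw [inducedEnd, hc, endAlong_id, MonoidHom.comp_id]⟩

theorem inducedEnd_comp (x : X) (f g : C(X, X)) :
    ∃ c : FundamentalGroup X x, inducedEnd x (f.comp g) =
      (MulAut.conj c).toMonoidHom.comp ((inducedEnd x f).comp (inducedEnd x g)) := by
  rw [inducedEnd, inducedEnd, inducedEnd, ← endAlong_comp]
  exact endAlong_of_homotopy (.refl (f.comp g)) _ _

theorem inducedEnd_comp_bijective (x : X) {f g : C(X, X)}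
    (h : ProperlyHomotopic (f.comp g) (ContinuousMap.id X)) :
    Function.Bijective (inducedEnd x f ∘ inducedEnd x g) := by
  obtain ⟨H, -⟩ := h
  obtain ⟨c, hc⟩ := inducedEnd_comp x f g
  obtain ⟨d, hd⟩ := inducedEnd_of_homotopy x H
  obtain ⟨e, he⟩ := inducedEnd_id x
  have key : ∀ γ, MulAut.conj e γ =
      MulAut.conj d (MulAut.conj c ((inducedEnd x f ∘ inducedEnd x g) γ)) := by
    intro γ
    have := DFunLike.congr_fun (he.symm.trans hd) γ
    rw [hc] at this
    exact this
  have : inducedEnd x f ∘ inducedEnd x g =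
      ⇑((MulAut.conj c)⁻¹ * ((MulAut.conj d)⁻¹ * MulAut.conj e)) := by
    funext γ
    change _ = (MulAut.conj c)⁻¹ ((MulAut.conj d)⁻¹ (MulAut.conj e γ))
    rw [key γ, MulAut.inv_apply_self, MulAut.inv_apply_self]
  rw [this]
  exact MulEquiv.bijective _

theorem inducedEnd_bijective (x : X) (f : ProperHomotopyEquivs X) :
    Function.Bijective (inducedEnd x f.1) :=
  ⟨(inducedEnd_comp_bijective x f.inverse_comp).1.of_comp,
    (inducedEnd_comp_bijective x f.comp_inverse).2.of_comp⟩

/-- The automorphism of `π₁(X, x)` induced by a proper homotopy equivalence. -/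
noncomputable def inducedAut (x : X) (f : ProperHomotopyEquivs X) : MulAut (FundamentalGroup X x) :=
  MulEquiv.ofBijective (inducedEnd x f.1) (inducedEnd_bijective x f)

/-- The natural homomorphism `Ψ : Maps(X) → Out(π₁(X, x))`, which sends the class of `h` to the
outer automorphism class of `h_*`. -/
noncomputable def Psi (x : X) : Maps X →* Out (FundamentalGroup X x) :=
  MonoidHom.mk' (Quotient.lift (fun f => (QuotientGroup.mk (inducedAut x f) :
      Out (FundamentalGroup X x))) (by
        rintro f g ⟨H, -⟩
        obtain ⟨c, hc⟩ := inducedEnd_of_homotopy x H.symm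
        have h : inducedAut x f = MulAut.conj c * inducedAut x g :=
          MulEquiv.ext fun γ => DFunLike.congr_fun hc γ
        have hn : (QuotientGroup.mk (MulAut.conj c) : Out (FundamentalGroup X x)) = 1 :=
          (QuotientGroup.eq_one_iff _).2 ⟨c, rfl⟩
        change (QuotientGroup.mk (inducedAut x f) : Out (FundamentalGroup X x)) = _
        rw [h, QuotientGroup.mk_mul, hn, one_mul])) (by
    rintro ⟨f⟩ ⟨g⟩
    obtain ⟨c, hc⟩ := inducedEnd_comp x f.1 g.1
    have h : inducedAut x ⟨f.1.comp g.1, f.2.comp g.2⟩ =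
        MulAut.conj c * (inducedAut x f * inducedAut x g) :=
      MulEquiv.ext fun γ => DFunLike.congr_fun hc γ
    have hn : (QuotientGroup.mk (MulAut.conj c) : Out (FundamentalGroup X x)) = 1 :=
      (QuotientGroup.eq_one_iff _).2 ⟨c, rfl⟩
    change (QuotientGroup.mk (inducedAut x ⟨f.1.comp g.1, f.2.comp g.2⟩) :
      Out (FundamentalGroup X x)) = QuotientGroup.mk (inducedAut x f) *
        QuotientGroup.mk (inducedAut x g)
    rw [h, QuotientGroup.mk_mul, hn, one_mul, QuotientGroup.mk_mul])

theorem Psi_mk (x : X) (f : ProperHomotopyEquivs X) :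
    Psi x (Maps.mk f) = QuotientGroup.mk (inducedAut x f) := rfl

end Induced

/-!
A core graph `X` is treated as a space glued from edges (`TopGraph`). For a set `M` of edges,
`G.Avoid M` is `X` with the midpoints of the edges in `M` removed; "a class of paths avoids `M`"
means that it comes from `G.Avoid M`. The homotopy from `f` to the identity is built edge by edge
and kept away from as many midpoints as possible, which makes it proper.

*Homotopy classes are reduced words.* A path crossing the midpoint of an edge moves the sheets of a
covering with fibre the free group on the edges (`wordCore`), so homotopic walks spell the same
element of this group (`Walk.mk_word_eq`). Conversely every path in `G.Avoid M` between vertices is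
homotopic there to an edge walk (`Walk.exists_cls_eq_mk`), which may be taken reduced. Hence paths
avoiding `M` that are homotopic in `X` are homotopic avoiding `M` (`ofSubtype_injective`), and a
class of paths has a representative avoiding every midpoint that can be avoided
(`exists_tight_path`). A computation with reduced words, the malnormality of free factors, shows
that a class `τ` conjugating an essential loop avoiding `M` into a loop avoiding `M` itself avoids
`M` (`exists_ofSubtype_eq_of_conj`).

*Core graphs have essential loops near infinity.* An immersed loop follows a cyclically reduced
closed walk (`exists_isCyclicallyReduced_walk`), so in a core graph every vertex lies on one
(`IsCoreGraph.exists_topGraph_walk`). It follows that for finite `M` all but finitely many vertices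
carry an essential loop avoiding `M` (`finite_setOf_no_loop`).

*The homotopy.* That `f` induces the identity in `Out(π₁)` yields classes `τ x` of paths from `x` to
`f x` that are natural in `x` (`InducesIdentityInOut.exists_track`). By the previous paragraph
applied to a set of edges enlarged by those that `f` maps across midpoints of `M`, the class `τ v`
avoids a given finite `M` for all but finitely many vertices `v` (`finite_setOf_track_not_avoid`).
With tight representatives of the `τ v`, the square spanned by an edge, its image under `f` and the
tracks of its ends is filled without crossing any midpoint that is not on its boundary
(`exists_edge_square`). For compact `K`, let `M` consist of the edges at the ends of the edges
meeting `K`. Almost all squares avoid `M`, and being connected they cannot reach `K`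
(`disjoint_of_avoid`). So the squares fit together to a proper homotopy
(`properlyHomotopic_id_of_tracks`). Injectivity of `Ψ` is the case of proper homotopy equivalences.
-/


/-! ### Graphs as spaces glued from edges -/

/-- A presentation of a space `X` as a locally finite graph with vertex set `V` and edge set `E`,
every vertex of which lies on some edge. Edges are oriented and parametrised by the unit interval;
the topology is the weak one determined by the edges. -/
structure TopGraph (X V E : Type*) [TopologicalSpace X] where
  /-- The point of `X` at which a vertex sits. -/
  pt : V → X
  /-- The initial vertex of an edge. -/
  src : E → V
  /-- The terminal vertex of an edge. -/
  tgt : E → V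
  /-- The parametrisation of an edge. -/
  edge : ∀ e, Path (pt (src e)) (pt (tgt e))
  pt_injective : Function.Injective pt
  edge_ne_pt : ∀ (e : E) (s : I) (v : V), 0 < s → s < 1 → edge e s ≠ pt v
  edge_inj : ∀ (e e' : E) (s s' : I), 0 < s → s < 1 → edge e s = edge e' s' → e = e' ∧ s = s'
  exists_edge : ∀ x, ∃ e s, edge e s = x
  isClosed_of_edge : ∀ A : Set X, (∀ e, IsClosed (edge e ⁻¹' A)) → IsClosed A
  finite_star : ∀ v, {e | src e = v ∨ tgt e = v}.Finite

/-- The midpoint of the unit interval. -/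
noncomputable def half : I := ⟨1 / 2, by norm_num, by norm_num⟩

@[simp] theorem coe_half : (half : ℝ) = 1 / 2 := rfl

theorem half_pos' : (0 : I) < half := by rw [← Subtype.coe_lt_coe]; norm_num

theorem half_lt_one' : half < (1 : I) := by rw [← Subtype.coe_lt_coe]; norm_num

namespace TopGraph

variable {X V E : Type*} [TopologicalSpace X] (G : TopGraph X V E)

theorem edge_eq_pt {e : E} {s : I} {v : V} (h : G.edge e s = G.pt v) :
    (s = 0 ∧ G.src e = v) ∨ (s = 1 ∧ G.tgt e = v) := by
  rcases eq_or_ne s 0 with rfl | h0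
  · exact .inl ⟨rfl, G.pt_injective (by simpa using h)⟩
  rcases eq_or_ne s 1 with rfl | h1
  · exact .inr ⟨rfl, G.pt_injective (by simpa using h)⟩
  exact absurd h (G.edge_ne_pt e s v (unitInterval.pos_iff_ne_zero.2 h0)
    (unitInterval.lt_one_iff_ne_one.2 h1))

theorem isOpen_of_edge (A : Set X) (h : ∀ e, IsOpen (G.edge e ⁻¹' A)) : IsOpen A := by
  rw [← isClosed_compl_iff]
  exact G.isClosed_of_edge _ fun e => by rw [preimage_compl, isClosed_compl_iff]; exact h e

/-- The image of an open subset of the open edge is open. -/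
theorem isOpen_edge_image (e : E) {J : Set I} (hJ : IsOpen J) (h : J ⊆ Ioo 0 1) :
    IsOpen (G.edge e '' J) := by
  refine G.isOpen_of_edge _ fun e' => ?_
  by_cases he : e' = e
  · subst he
    convert hJ using 1
    ext s
    refine ⟨?_, fun hs => ⟨s, hs, rfl⟩⟩
    rintro ⟨s', hs', h'⟩
    obtain ⟨-, rfl⟩ := G.edge_inj _ _ _ _ (h hs').1 (h hs').2 h'
    exact hs'
  · convert isOpen_empty using 1
    refine eq_empty_of_forall_notMem fun s => ?_
    rintro ⟨s', hs', h'⟩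
    exact he (G.edge_inj _ _ _ _ (h hs').1 (h hs').2 h').1.symm

/-- The open star of radius `a` around a vertex. -/
def star (v : V) (a : ℝ) : Set X :=
  {x | ∃ e s, G.edge e s = x ∧ ((G.src e = v ∧ (s : ℝ) < a) ∨ (G.tgt e = v ∧ 1 - (s : ℝ) < a))}

theorem edge_mem_star {v : V} {a : ℝ} (h0 : 0 < a) (ha : a ≤ 1) (e : E) (s : I) :
    G.edge e s ∈ G.star v a ↔
      ((G.src e = v ∧ (s : ℝ) < a) ∨ (G.tgt e = v ∧ 1 - (s : ℝ) < a)) := by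
  refine ⟨?_, fun h => ⟨e, s, rfl, h⟩⟩
  rintro ⟨e', s', h, h'⟩
  by_cases hs : 0 < s ∧ s < 1
  · obtain ⟨rfl, rfl⟩ := G.edge_inj _ _ _ _ hs.1 hs.2 h.symm
    exact h'
  · have hv : G.edge e' s' = G.pt v := by
      have : ∃ w, G.edge e s = G.pt w := by
        by_cases h0 : s = 0
        · exact ⟨G.src e, by simp [h0]⟩
        · by_cases h1 : s = 1
          · exact ⟨G.tgt e, by simp [h1]⟩
          · exact absurd ⟨unitInterval.pos_iff_ne_zero.2 h0, unitInterval.lt_one_iff_ne_one.2 h1⟩ hs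
      obtain ⟨w, hw⟩ := this
      rw [hw] at h
      rcases G.edge_eq_pt h with ⟨rfl, h2⟩ | ⟨rfl, h2⟩ <;> rcases h' with ⟨h3, h4⟩ | ⟨h3, h4⟩
      · simp [h3]
      · simp only [Icc.coe_zero, sub_zero] at h4; linarith
      · simp only [Icc.coe_one] at h4; linarith
      · simp [h3]
    rw [h] at hv
    rcases G.edge_eq_pt hv with ⟨rfl, h2⟩ | ⟨rfl, h2⟩
    · exact .inl ⟨h2, by simpa using h0⟩
    · exact .inr ⟨h2, by simpa using h0⟩

theorem isOpen_star {v : V} {a : ℝ} (h0 : 0 < a) (ha : a ≤ 1) : IsOpen (G.star v a) := by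
  refine G.isOpen_of_edge _ fun e => ?_
  have : G.edge e ⁻¹' G.star v a = {s : I | (G.src e = v ∧ (s : ℝ) < a)} ∪
      {s : I | (G.tgt e = v ∧ 1 - (s : ℝ) < a)} := by
    ext s; exact G.edge_mem_star h0 ha e s
  rw [this]
  refine IsOpen.union ?_ ?_
  · by_cases h : G.src e = v
    · simpa [h] using isOpen_lt continuous_subtype_val continuous_const
    · simp [h]
  · by_cases h : G.tgt e = v
    · simpa [h] using isOpen_lt (continuous_const.sub continuous_subtype_val) continuous_const
    · simp [h]

theorem exists_endpoint (v : V) : ∃ e, G.src e = v ∨ G.tgt e = v := by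
  obtain ⟨e, s, h⟩ := G.exists_edge (G.pt v)
  rcases G.edge_eq_pt h with ⟨-, h⟩ | ⟨-, h⟩
  exacts [⟨e, .inl h⟩, ⟨e, .inr h⟩]

theorem pt_mem_star (v : V) {a : ℝ} (h0 : 0 < a) : G.pt v ∈ G.star v a := by
  obtain ⟨e, h | h⟩ := G.exists_endpoint v
  · exact ⟨e, 0, by simp [h], .inl ⟨h, by simpa using h0⟩⟩
  · exact ⟨e, 1, by simp [h], .inr ⟨h, by simpa using h0⟩⟩

/-- A point is a vertex or an interior point of an edge. -/
theorem vertex_or_interior (x : X) : (∃ v, x = G.pt v) ∨ ∃ e s, 0 < s ∧ s < 1 ∧ G.edge e s = x := by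
  obtain ⟨e, s, rfl⟩ := G.exists_edge x
  rcases eq_or_ne s 0 with rfl | h0
  · exact .inl ⟨G.src e, by simp⟩
  rcases eq_or_ne s 1 with rfl | h1
  · exact .inl ⟨G.tgt e, by simp⟩
  exact .inr ⟨e, s, unitInterval.pos_iff_ne_zero.2 h0, unitInterval.lt_one_iff_ne_one.2 h1, rfl⟩

theorem locallyFinite_edge : LocallyFinite fun e => range (G.edge e) := by
  intro x
  rcases G.vertex_or_interior x with ⟨v, rfl⟩ | ⟨e, s, h0, h1, rfl⟩
  · refine ⟨G.star v 1, (G.isOpen_star one_pos le_rfl).mem_nhds (G.pt_mem_star v one_pos),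
      (G.finite_star v).subset ?_⟩
    rintro e ⟨x, ⟨s, rfl⟩, hx⟩
    rw [G.edge_mem_star one_pos le_rfl] at hx
    exact hx.imp And.left And.left
  · refine ⟨G.edge e '' Ioo 0 1, (G.isOpen_edge_image e isOpen_Ioo subset_rfl).mem_nhds
      ⟨s, ⟨h0, h1⟩, rfl⟩, (finite_singleton e).subset ?_⟩
    rintro e' ⟨x, ⟨s, rfl⟩, ⟨s', hs', h⟩⟩
    exact (G.edge_inj _ _ _ _ hs'.1 hs'.2 h).1.symm

theorem finite_meets_compact {K : Set X} (hK : IsCompact K) :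
    {e | (range (G.edge e) ∩ K).Nonempty}.Finite :=
  G.locallyFinite_edge.finite_nonempty_inter_compact hK

/-- Maps `A × X → Y` may be defined edge by edge: the sets `A × edge` form a locally finite closed
cover, and `A × I → A × edge` is a proper map. -/
theorem exists_glue [T2Space X] {A Y : Type*} [TopologicalSpace A] [TopologicalSpace Y]
    (g : E → C(A × I, Y)) (k : V → A → Y) (h0 : ∀ e a, g e (a, 0) = k (G.src e) a)
    (h1 : ∀ e a, g e (a, 1) = k (G.tgt e) a) :
    ∃ H : C(A × X, Y), ∀ e a s, H (a, G.edge e s) = g e (a, s) := by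
  choose ed pa hpa using G.exists_edge
  let h : A × X → Y := fun p => g (ed p.2) (p.1, pa p.2)
  have hh : ∀ e a s, h (a, G.edge e s) = g e (a, s) := by
    intro e a s
    have hx := hpa (G.edge e s)
    by_cases hs : 0 < s ∧ s < 1
    · obtain ⟨h2, h3⟩ := G.edge_inj _ _ _ _ hs.1 hs.2 hx.symm
      simp only [h]
      rw [← h2, ← h3]
    · have key : ∀ e s v, G.edge e s = G.pt v → g e (a, s) = k v a := by
        intro e s v h
        rcases G.edge_eq_pt h with ⟨rfl, rfl⟩ | ⟨rfl, rfl⟩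
        exacts [h0 _ _, h1 _ _]
      have : ∃ v, G.edge e s = G.pt v := by
        by_cases h0 : s = 0
        · exact ⟨G.src e, by simp [h0]⟩
        · by_cases h1 : s = 1
          · exact ⟨G.tgt e, by simp [h1]⟩
          · exact absurd ⟨unitInterval.pos_iff_ne_zero.2 h0, unitInterval.lt_one_iff_ne_one.2 h1⟩ hs
      obtain ⟨v, hv⟩ := this
      rw [key e s v hv, ← key _ _ v (hx.trans hv)]
  have hlf : LocallyFinite fun e => (univ : Set A) ×ˢ range (G.edge e) := by
    intro p
    obtain ⟨t, ht, hf⟩ := G.locallyFinite_edge p.2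
    refine ⟨univ ×ˢ t, prod_mem_nhds Filter.univ_mem ht, hf.subset ?_⟩
    rintro e ⟨q, hq, hq'⟩
    exact ⟨q.2, hq.2, hq'.2⟩
  have hpr : ∀ e, IsProperMap (Prod.map (id : A → A) (G.edge e)) := fun e =>
    isProperMap_id.prodMap (G.edge e).continuous.isProperMap
  have him : ∀ e (B : Set (A × I)), Prod.map id (G.edge e) '' B ⊆ univ ×ˢ range (G.edge e) := by
    rintro e B _ ⟨p, -, rfl⟩
    exact ⟨mem_univ _, p.2, rfl⟩
  refine ⟨⟨h, hlf.continuous ?_ ?_ ?_⟩, hh⟩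
  · refine eq_univ_of_forall fun p => ?_
    obtain ⟨e, s, hs⟩ := G.exists_edge p.2
    exact mem_iUnion.2 ⟨e, mem_univ _, s, hs⟩
  · exact fun e => isClosed_univ.prod (isCompact_range (G.edge e).continuous).isClosed
  · intro e
    rw [continuousOn_iff_isClosed]
    intro C hC
    refine ⟨Prod.map id (G.edge e) '' (g e ⁻¹' C),
      (hpr e).isClosedMap _ (hC.preimage (g e).continuous), ?_⟩
    rw [inter_eq_left.2 (him e _)]
    ext ⟨a, x⟩
    constructor
    · rintro ⟨h1, -, s, rfl⟩
      exact ⟨(a, s), by simpa [hh] using h1, rfl⟩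
    · rintro ⟨⟨a, s⟩, h1, h2⟩
      obtain ⟨rfl, rfl⟩ := Prod.mk.inj h2
      exact ⟨by simpa [hh] using h1, mem_univ _, s, rfl⟩

end TopGraph

namespace TopGraph

variable {X V E : Type*} [TopologicalSpace X] (G : TopGraph X V E)

/-! ### The crossing-word covering -/

/-- The set of midpoints of edges. -/
def mids : Set X := range fun e => G.edge e half

theorem edge_mem_mids {e : E} {s : I} : G.edge e s ∈ G.mids ↔ s = half := by
  constructor
  · rintro ⟨e', h⟩
    exact (G.edge_inj _ _ _ _ half_pos' half_lt_one' h).2.symm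
  · rintro rfl; exact ⟨e, rfl⟩

/-- The union of the open edges. -/
def openEdges : Set X := ⋃ e, G.edge e '' Ioo 0 1

open Classical in
/-- The letter of an edge on the second half of that edge, and the neutral element elsewhere. -/
noncomputable def halfLetter (x : X) : FreeGroup E :=
  if h : ∃ e : E, ∃ s : I, half < s ∧ s < 1 ∧ G.edge e s = x then FreeGroup.of h.choose else 1

theorem halfLetter_of_gt {e : E} {s : I} (h : half < s) (h1 : s < 1) :
    G.halfLetter (G.edge e s) = FreeGroup.of e := by
  have hx : ∃ e' : E, ∃ s' : I, half < s' ∧ s' < 1 ∧ G.edge e' s' = G.edge e s := ⟨e, s, h, h1, rfl⟩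
  rw [halfLetter, dif_pos hx]
  obtain ⟨s', h2, h3, h4⟩ := hx.choose_spec
  rw [(G.edge_inj _ _ _ _ (half_pos'.trans h2) h3 h4).1]

theorem halfLetter_of_le {e : E} {s : I} (h : s ≤ half) :
    G.halfLetter (G.edge e s) = 1 := by
  rw [halfLetter, dif_neg]
  rintro ⟨e', s', h2, h3, h4⟩
  have := (G.edge_inj _ _ _ _ (half_pos'.trans h2) h3 h4).2
  rw [this] at h2
  exact absurd h2 h.not_gt

-- the fibres of the covering are discrete
local instance : TopologicalSpace (FreeGroup E) := ⊥
local instance : DiscreteTopology (FreeGroup E) := ⟨rfl⟩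

theorem continuousOn_halfLetter : ContinuousOn G.halfLetter (G.midsᶜ ∩ G.openEdges) := by
  rintro x ⟨hx, hx'⟩
  obtain ⟨e, s, ⟨h0, h1⟩, rfl⟩ := mem_iUnion.1 hx'
  have hs : s ≠ half := fun h => hx (G.edge_mem_mids.2 h)
  refine ContinuousAt.continuousWithinAt ?_
  rcases hs.lt_or_gt with h | h
  · refine continuousAt_const.congr (f := fun _ => (1 : FreeGroup E)) ?_
    filter_upwards [(G.isOpen_edge_image e (J := Ioo 0 half) isOpen_Ioo
      (Ioo_subset_Ioo_right half_lt_one'.le)).mem_nhds ⟨s, ⟨h0, h⟩, rfl⟩]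
    rintro _ ⟨s', hs', rfl⟩
    exact (G.halfLetter_of_le hs'.2.le).symm
  · refine continuousAt_const.congr (f := fun _ => FreeGroup.of e) ?_
    filter_upwards [(G.isOpen_edge_image e (J := Ioo half 1) isOpen_Ioo
      (Ioo_subset_Ioo_left half_pos'.le)).mem_nhds ⟨s, ⟨h, h1⟩, rfl⟩]
    rintro _ ⟨s', hs', rfl⟩
    exact (G.halfLetter_of_gt hs'.1 hs'.2).symm

theorem isOpen_compl_mids : IsOpen G.midsᶜ := by
  refine G.isOpen_of_edge _ fun e => ?_
  have : G.edge e ⁻¹' G.midsᶜ = {half}ᶜ := by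
    ext s; simp [G.edge_mem_mids]
  rw [this]
  exact isOpen_compl_singleton

theorem isOpen_openEdges : IsOpen G.openEdges :=
  isOpen_iUnion fun e => G.isOpen_edge_image e isOpen_Ioo subset_rfl

theorem mids_subset_openEdges : G.mids ⊆ G.openEdges := by
  rintro _ ⟨e, rfl⟩
  exact mem_iUnion.2 ⟨e, half, ⟨half_pos', half_lt_one'⟩, rfl⟩

/-- The change of coordinates from the chart `i` to the chart `j` of the crossing-word covering. -/
noncomputable def wordTransition (i j : Bool) (x : X) : FreeGroup E :=
  match i, j with
  | true, false => (G.halfLetter x)⁻¹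
  | false, true => G.halfLetter x
  | _, _ => 1

open Classical in
/-- The covering of a graph with fibre the free group on its edges, in which a path crossing the
midpoint of an edge picks up the corresponding letter. It is glued from two charts: the complement
of the midpoints (`true`), and the union of the open edges (`false`). -/
noncomputable def wordCore : FiberBundleCore Bool X (FreeGroup E) where
  baseSet i := if i then G.midsᶜ else G.openEdges
  isOpen_baseSet i := by cases i; exacts [G.isOpen_openEdges, G.isOpen_compl_mids]
  indexAt x := if x ∈ G.mids then false else true
  mem_baseSet_at x := by
    by_cases h : x ∈ G.mids
    · simpa [h] using G.mids_subset_openEdges h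
    · simp [h]
  coordChange i j x g := g * G.wordTransition i j x
  coordChange_self i x _ g := by cases i <;> simp [wordTransition]
  continuousOn_coordChange i j := by
    have hc : ContinuousOn (G.wordTransition i j)
        ((if i then G.midsᶜ else G.openEdges) ∩ (if j then G.midsᶜ else G.openEdges)) := by
      cases i <;> cases j
      · exact continuousOn_const
      · have := G.continuousOn_halfLetter
        rw [inter_comm] at this
        exact this
      · have := G.continuousOn_halfLetter
        exact (continuous_of_discreteTopology (f := fun g : FreeGroup E => g⁻¹)).comp_continuousOn
          this
      · exact continuousOn_const
    have hm : Continuous fun p : FreeGroup E × FreeGroup E => p.1 * p.2 :=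
      continuous_of_discreteTopology
    exact hm.comp_continuousOn (continuousOn_snd.prodMk
      (hc.comp continuousOn_fst fun p hp => hp.1))
  coordChange_comp i j k x _ g := by
    cases i <;> cases j <;> cases k <;> simp [wordTransition]

theorem wordCore_isCoveringMap : IsCoveringMap (Bundle.TotalSpace.proj :
    G.wordCore.TotalSpace → X) :=
  FiberBundle.isCoveringMap

/-- The point of the crossing-word covering over `x` with coordinate `g`. -/
noncomputable def wordPt (x : X) (g : FreeGroup E) : G.wordCore.TotalSpace := ⟨x, g⟩

/-- The point of the fibre over `x` with coordinate `g`. -/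
noncomputable def fiberPt (x : X) (g : FreeGroup E) :
    (Bundle.TotalSpace.proj : G.wordCore.TotalSpace → X) ⁻¹' {x} :=
  ⟨G.wordPt x g, rfl⟩

theorem fiberPt_injective (x : X) : Function.Injective (G.fiberPt x) := by
  intro g g' h
  have h1 : G.wordPt x g = G.wordPt x g' := congrArg Subtype.val h
  injection h1

theorem indexAt_edge_of_ne {e : E} {s : I} (h : s ≠ half) :
    G.wordCore.indexAt (G.edge e s) = true := by
  simp [wordCore, G.edge_mem_mids, h]

theorem indexAt_edge_half {e : E} : G.wordCore.indexAt (G.edge e half) = false := by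
  simp [wordCore, G.edge_mem_mids]

open Classical in
/-- The lift of an edge to the crossing-word covering. -/
noncomputable def edgeLift (e : E) (g : FreeGroup E) (s : I) : G.wordCore.TotalSpace :=
  G.wordPt (G.edge e s) (if s ≤ half then g else g * FreeGroup.of e)

theorem continuous_edgeLift (e : E) (g : FreeGroup E) : Continuous (G.edgeLift e g) := by
  classical
  rw [continuous_iff_continuousAt]
  intro s
  -- near `s` it suffices to check continuity in some chart `i`
  have key : ∀ (i : Bool) (J : Set I) (c : I → FreeGroup E), IsOpen J → s ∈ J →
      (∀ t ∈ J, G.edge e t ∈ (G.wordCore.localTriv i).baseSet) → ContinuousOn c J →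
      (∀ t ∈ J, (if t ≤ half then g else g * FreeGroup.of e) = c t * G.wordTransition i
        (G.wordCore.indexAt (G.edge e t)) (G.edge e t)) →
      ContinuousAt (G.edgeLift e g) s := by
    intro i J c hJ hs hb hc heq
    have h1 : ContinuousOn (fun t : I => (G.wordCore.localTriv i).toOpenPartialHomeomorph.symm
        (G.edge e t, c t)) J := by
      refine (G.wordCore.localTriv i).toOpenPartialHomeomorph.continuousOn_symm.comp
        ((G.edge e).continuous.continuousOn.prodMk hc) ?_
      intro t ht
      rw [(G.wordCore.localTriv i).target_eq]
      exact ⟨hb t ht, mem_univ _⟩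
    exact (h1.congr fun t ht => congrArg (G.wordPt _) (heq t ht)).continuousAt (hJ.mem_nhds hs)
  -- the chart of the open edges at the midpoint, and the other chart away from it
  by_cases hs : s = half
  · refine key false (Ioo 0 1) (fun _ => g) isOpen_Ioo (hs ▸ ⟨half_pos', half_lt_one'⟩)
      (fun t ht => mem_iUnion.2 ⟨e, t, ht, rfl⟩) continuousOn_const ?_
    intro t ht
    rcases lt_trichotomy t half with h | h | h
    · rw [if_pos h.le, G.indexAt_edge_of_ne h.ne]
      simp [wordTransition, G.halfLetter_of_le h.le]
    · rw [if_pos h.le, h, G.indexAt_edge_half]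
      simp [wordTransition]
    · rw [if_neg h.not_ge, G.indexAt_edge_of_ne h.ne']
      simp [wordTransition, G.halfLetter_of_gt h ht.2]
  · refine key true {half}ᶜ (fun t => if t ≤ half then g else g * FreeGroup.of e)
      isOpen_compl_singleton hs (fun t ht => ?_) ?_ ?_
    · change G.edge e t ∈ G.midsᶜ
      simpa [G.edge_mem_mids] using ht
    · intro t ht
      refine ContinuousAt.continuousWithinAt ?_
      rcases lt_or_gt_of_ne (show t ≠ half from ht) with h | h
      · refine continuousAt_const.congr (f := fun _ => g) ?_
        filter_upwards [Iio_mem_nhds h] with u hu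
        rw [if_pos (le_of_lt hu)]
      · refine continuousAt_const.congr (f := fun _ => g * FreeGroup.of e) ?_
        filter_upwards [Ioi_mem_nhds h] with u hu
        rw [if_neg (not_le.2 hu)]
    · intro t ht
      rw [G.indexAt_edge_of_ne ht]
      simp [wordTransition]

/-- Parallel transport along an edge multiplies the coordinate by the letter of that edge. -/
theorem monodromy_edge (e : E) (g : FreeGroup E) :
    G.wordCore_isCoveringMap.monodromy (.mk (G.edge e)) (G.fiberPt (G.pt (G.src e)) g) =
      G.fiberPt (G.pt (G.tgt e)) (g * FreeGroup.of e) := by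
  apply Subtype.ext
  have h := (G.wordCore_isCoveringMap.eq_liftPath_iff (γ := (G.edge e : C(I, X)))
    (e := G.wordPt (G.pt (G.src e)) g) (by simp [wordPt]) (Γ := G.edgeLift e g)).2
    ⟨G.continuous_edgeLift e g, rfl, by
      rw [edgeLift, if_pos half_pos'.le]; exact congrArg (G.wordPt · g) (G.edge e).source⟩
  refine (congr_fun h 1).symm.trans ?_
  rw [edgeLift, if_neg half_lt_one'.not_ge]
  exact congrArg (G.wordPt · _) (G.edge e).target

theorem monodromy_edge_symm (e : E) (g : FreeGroup E) :
    G.wordCore_isCoveringMap.monodromy (.mk (G.edge e).symm) (G.fiberPt (G.pt (G.tgt e)) g) =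
      G.fiberPt (G.pt (G.src e)) (g * (FreeGroup.of e)⁻¹) := by
  have h := G.monodromy_edge e (g * (FreeGroup.of e)⁻¹)
  rw [inv_mul_cancel_right] at h
  rw [← h, ← IsCoveringMap.monodromy_trans_apply, Path.Homotopic.Quotient.mk_symm,
    Path.Homotopic.Quotient.trans_symm, IsCoveringMap.monodromy_refl]
  rfl

/-! ### Edge walks -/

/-- The initial vertex of a letter, which is an edge (`true`) or the reverse of one (`false`). -/
def dartSrc (d : E × Bool) : V := bif d.2 then G.src d.1 else G.tgt d.1

/-- The terminal vertex of a letter. -/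
def dartTgt (d : E × Bool) : V := bif d.2 then G.tgt d.1 else G.src d.1

/-- The path along an oriented edge. -/
def dart : ∀ d : E × Bool, Path (G.pt (G.dartSrc d)) (G.pt (G.dartTgt d))
  | (e, true) => G.edge e
  | (e, false) => (G.edge e).symm

/-- The graph with the midpoints of the edges in `M` removed. -/
def Avoid (M : Set E) : Set X := {x | ∀ e ∈ M, x ≠ G.edge e half}

variable {G}

theorem pt_mem_avoid (M : Set E) (v : V) : G.pt v ∈ G.Avoid M :=
  fun e _ h => G.edge_ne_pt e half v half_pos' half_lt_one' h.symm

theorem edge_mem_avoid {M : Set E} {e : E} {s : I} :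
    G.edge e s ∈ G.Avoid M ↔ (e ∈ M → s ≠ half) := by
  refine ⟨fun h he hs => h e he (by rw [hs]), fun h e' he' hs => ?_⟩
  obtain ⟨rfl, rfl⟩ := G.edge_inj _ _ _ _ half_pos' half_lt_one' hs.symm
  exact h he' rfl

theorem avoid_anti {M N : Set E} (h : M ⊆ N) : G.Avoid N ⊆ G.Avoid M :=
  fun _ hx e he => hx e (h he)

theorem dart_mem_avoid {M : Set E} {d : E × Bool} (hd : d.1 ∉ M) (s : I) :
    G.dart d s ∈ G.Avoid M := by
  obtain ⟨e, _ | _⟩ := d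
  · exact edge_mem_avoid.2 fun h => absurd h hd
  · exact edge_mem_avoid.2 fun h => absurd h hd

end TopGraph

/-- A path whose points lie in `S`, as a path in the subspace `S`. -/
def Path.inSubtype {X : Type*} [TopologicalSpace X] {S : Set X} {x y : X} (p : Path x y)
    (h : ∀ t, p t ∈ S) :
    Path (⟨x, p.source ▸ h 0⟩ : S) ⟨y, p.target ▸ h 1⟩ where
  toFun t := ⟨p t, h t⟩
  continuous_toFun := by fun_prop
  source' := Subtype.ext p.source
  target' := Subtype.ext p.target

namespace Path.Homotopic.Quotient

variable {X : Type*} [TopologicalSpace X] {S : Set X}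

/-- The homotopy class in the whole space of a homotopy class of paths in a subspace. -/
def ofSubtype {x y : S} (c : Path.Homotopic.Quotient x y) :
    Path.Homotopic.Quotient (x : X) (y : X) :=
  c.map ⟨Subtype.val, continuous_subtype_val⟩

@[simp] theorem ofSubtype_refl (x : S) : ofSubtype (.refl x) = .refl (x : X) := rfl

@[simp] theorem ofSubtype_trans {x y z : S} (c : Path.Homotopic.Quotient x y)
    (d : Path.Homotopic.Quotient y z) :
    ofSubtype (c.trans d) = (ofSubtype c).trans (ofSubtype d) := by
  obtain ⟨c⟩ := c
  obtain ⟨d⟩ := d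
  exact congrArg Path.Homotopic.Quotient.mk (Path.map_trans _ _ _)

@[simp] theorem ofSubtype_symm {x y : S} (c : Path.Homotopic.Quotient x y) :
    ofSubtype c.symm = (ofSubtype c).symm := by
  obtain ⟨c⟩ := c
  rfl

@[simp] theorem ofSubtype_mk_inSubtype {x y : X} (p : Path x y) (h : ∀ t, p t ∈ S) :
    ofSubtype (.mk (p.inSubtype h)) = .mk p := rfl

end Path.Homotopic.Quotient

namespace TopGraph

variable {X V E : Type*} [TopologicalSpace X] (G : TopGraph X V E)

/-- Edge walks between two vertices that use no edge of `M`. -/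
inductive Walk (M : Set E) : V → V → Type _
  | nil (v : V) : Walk M v v
  | cons {u v : V} (d : E × Bool) (hd : d.1 ∉ M) (hu : G.dartSrc d = u)
      (w : Walk M (G.dartTgt d) v) : Walk M u v

variable {G}

/-- A vertex as a point of the space avoiding the midpoints of `M`. -/
abbrev ptIn (G : TopGraph X V E) (M : Set E) (v : V) : G.Avoid M := ⟨G.pt v, pt_mem_avoid M v⟩

/-- The homotopy class of an oriented edge not in `M`, in the space avoiding the midpoints of
`M`. -/
noncomputable def dartCls {M : Set E} (d : E × Bool) (hd : d.1 ∉ M) :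
    Path.Homotopic.Quotient (G.ptIn M (G.dartSrc d)) (G.ptIn M (G.dartTgt d)) :=
  .mk ((G.dart d).inSubtype (dart_mem_avoid hd))

namespace Walk

variable {M : Set E}

/-- The word spelled by a walk. -/
def word : ∀ {u v : V}, G.Walk M u v → List (E × Bool)
  | _, _, nil _ => []
  | _, _, cons d _ _ w => d :: w.word

/-- The homotopy class, in the space avoiding the midpoints of `M`, of the path along a walk. -/
noncomputable def cls :
    ∀ {u v : V}, G.Walk M u v → Path.Homotopic.Quotient (G.ptIn M u) (G.ptIn M v)
  | _, _, nil _ => .refl _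
  | _, _, cons d hd hu w => ((dartCls d hd).cast (congrArg (G.ptIn M) hu.symm) rfl).trans w.cls

@[simp] theorem cls_nil (v : V) : (nil v : G.Walk M v v).cls = .refl _ := rfl

theorem cls_cons {u v : V} (d : E × Bool) (hd : d.1 ∉ M) (hu : G.dartSrc d = u)
    (w : G.Walk M (G.dartTgt d) v) : (cons d hd hu w).cls =
      ((dartCls d hd).cast (congrArg (G.ptIn M) hu.symm) rfl).trans w.cls := rfl

theorem cls_single (d : E × Bool) (hd : d.1 ∉ M) :
    (cons d hd rfl (nil (G.dartTgt d)) : G.Walk M (G.dartSrc d) (G.dartTgt d)).cls =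
      dartCls d hd := by
  rw [cls_cons, cls_nil, Path.Homotopic.Quotient.trans_refl,
    Path.Homotopic.Quotient.cast_rfl_rfl]

/-- Concatenation of walks. -/
def append : ∀ {u v w : V}, G.Walk M u v → G.Walk M v w → G.Walk M u w
  | _, _, _, nil _, q => q
  | _, _, _, cons d hd hu p, q => cons d hd hu (p.append q)

@[simp] theorem word_append {u v w : V} (p : G.Walk M u v) (q : G.Walk M v w) :
    (p.append q).word = p.word ++ q.word := by
  induction p with
  | nil => rfl
  | cons d hd hu p ih => simp [append, word, ih]

theorem cls_append {u v w : V} (p : G.Walk M u v) (q : G.Walk M v w) :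
    (p.append q).cls = p.cls.trans q.cls := by
  induction p with
  | nil => simp [append, cls]
  | cons d hd hu p ih => simp only [append, cls, ih, Path.Homotopic.Quotient.trans_assoc]

/-- Parallel transport along a walk multiplies the coordinate by the word of the walk. -/
theorem monodromy_cls {u v : V} (w : G.Walk M u v) (g : FreeGroup E) :
    G.wordCore_isCoveringMap.monodromy (w.cls.ofSubtype) (G.fiberPt (G.pt u) g) =
      G.fiberPt (G.pt v) (g * FreeGroup.mk w.word) := by
  induction w generalizing g with
  | nil v =>
    rw [cls, Path.Homotopic.Quotient.ofSubtype_refl, IsCoveringMap.monodromy_refl]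
    simp [word, ← FreeGroup.one_eq_mk]
  | @cons u v d hd hu w ih =>
    subst hu
    rw [cls, Path.Homotopic.Quotient.cast_rfl_rfl, Path.Homotopic.Quotient.ofSubtype_trans,
      IsCoveringMap.monodromy_trans_apply, dartCls,
      Path.Homotopic.Quotient.ofSubtype_mk_inSubtype]
    have h2 : G.wordCore_isCoveringMap.monodromy (.mk (G.dart d))
        (G.fiberPt (G.pt (G.dartSrc d)) g) =
        G.fiberPt (G.pt (G.dartTgt d)) (g * FreeGroup.mk [d]) := by
      obtain ⟨e, _ | _⟩ := d
      · exact G.monodromy_edge_symm e g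
      · exact G.monodromy_edge e g
    rw [h2, ih, mul_assoc, FreeGroup.mul_mk]
    rfl

/-- The crossing word is a homotopy invariant: homotopic walks spell the same element of the free
group on the edges. -/
theorem mk_word_eq {N : Set E} {u v : V} {w : G.Walk M u v} {w' : G.Walk N u v}
    (h : w.cls.ofSubtype = w'.cls.ofSubtype) :
    FreeGroup.mk w.word = FreeGroup.mk w'.word := by
  have h1 := w.monodromy_cls 1
  have h2 := w'.monodromy_cls 1
  have h3 : G.fiberPt (G.pt v) (1 * FreeGroup.mk w.word) =
      G.fiberPt (G.pt v) (1 * FreeGroup.mk w'.word) := by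
    rw [← h1, ← h2]
    exact congrFun (congrArg _ h) _
  simpa using G.fiberPt_injective _ h3

end Walk

end TopGraph

namespace TopGraph

variable {X V E : Type*} [TopologicalSpace X] {G : TopGraph X V E}

/-! ### Normal forms of homotopy classes of paths -/

/-- A continuous map into an open edge is given by a continuous edge coordinate. -/
theorem exists_edge_coord {A : Type*} [TopologicalSpace A] {e : E} {c : A → X} (hc : Continuous c)
    (h : ∀ a, c a ∈ G.edge e '' Ioo 0 1) :
    ∃ q : C(A, I), ∀ a, q a ∈ Ioo 0 1 ∧ G.edge e (q a) = c a := by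
  choose q hq1 hq2 using h
  refine ⟨⟨q, continuous_def.2 fun U hU => ?_⟩, fun a => ⟨hq1 a, hq2 a⟩⟩
  have : q ⁻¹' U = c ⁻¹' (G.edge e '' (U ∩ Ioo 0 1)) := by
    ext a
    constructor
    · exact fun h => ⟨q a, ⟨h, hq1 a⟩, hq2 a⟩
    · rintro ⟨s, ⟨h1, h2⟩, h3⟩
      obtain ⟨-, h4⟩ := G.edge_inj _ _ _ _ h2.1 h2.2 (h3.trans (hq2 a).symm)
      exact (h4 ▸ h1 : q a ∈ U)
  rw [this]
  exact (G.isOpen_edge_image e (hU.inter isOpen_Ioo) inter_subset_right).preimage hc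

/-- A path in an edge that misses the midpoint stays on one side of it. -/
theorem side_of_ne_half {q : I → I} (hq : Continuous q) (h : ∀ r, q r ≠ half) :
    (∀ r, q r < half) ∨ ∀ r, half < q r := by
  by_contra hcon
  push Not at hcon
  obtain ⟨⟨a, ha⟩, ⟨b, hb⟩⟩ := hcon
  obtain ⟨r, hr⟩ := mem_range_of_exists_le_of_exists_ge hq ⟨b, hb⟩ ⟨a, ha⟩
  exact h r hr

theorem convex_lt {a b c t : ℝ} (ht : 0 ≤ t) (ht' : t ≤ 1) (ha : a < c) (hb : b < c) :
    (1 - t) * a + t * b < c := by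
  refine lt_of_le_of_lt ?_ (max_lt ha hb)
  nlinarith [mul_nonneg ht (sub_nonneg.2 (le_max_right a b)),
    mul_nonneg (sub_nonneg.2 ht') (sub_nonneg.2 (le_max_left a b))]

theorem lt_convex {a b c t : ℝ} (ht : 0 ≤ t) (ht' : t ≤ 1) (ha : c < a) (hb : c < b) :
    c < (1 - t) * a + t * b := by
  have := convex_lt ht ht' (neg_lt_neg ha) (neg_lt_neg hb)
  linarith

/-- Two paths inside one edge with the same ends are homotopic, without crossing any midpoint that
neither of them crosses. -/
theorem homotopic_of_edge {M : Set E} {a b : G.Avoid M} {γ γ' : Path a b} {e : E} {q q' : C(I, I)}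
    (h : ∀ r, (γ r : X) = G.edge e (q r)) (h' : ∀ r, (γ' r : X) = G.edge e (q' r))
    (h0 : q 0 = q' 0) (h1 : q 1 = q' 1) : γ.Homotopic γ' := by
  have hav : ∀ t r, G.edge e (Icc.convexComb (q r) (q' r) t) ∈ G.Avoid M := by
    intro t r
    rw [edge_mem_avoid]
    intro he
    have hq : ∀ r, q r ≠ half := fun r => edge_mem_avoid.1 (h r ▸ (γ r).2) he
    have hq' : ∀ r, q' r ≠ half := fun r => edge_mem_avoid.1 (h' r ▸ (γ' r).2) he
    have ht := t.2.1
    have ht' := t.2.2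
    intro hmid
    have hmid' : (1 - (t : ℝ)) * q r + t * q' r = 1 / 2 := by
      have := congrArg Subtype.val hmid
      simpa using this
    rcases side_of_ne_half q.continuous hq with hs | hs <;>
      rcases side_of_ne_half q'.continuous hq' with hs' | hs'
    · have h2 : (q r : ℝ) < 1 / 2 := hs r
      exact (convex_lt ht ht' h2 (hs' r)).ne hmid'
    · exact absurd (hs 0) (h0 ▸ (hs' 0).not_gt)
    · exact absurd (hs 0) (h0 ▸ (hs' 0).not_gt)
    · have h2 : 1 / 2 < (q r : ℝ) := hs r
      exact (lt_convex ht ht' h2 (hs' r)).ne' hmid'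
  refine ⟨⟨⟨⟨fun p => ⟨G.edge e (Icc.convexComb (q p.2) (q' p.2) p.1), hav p.1 p.2⟩, ?_⟩,
    fun r => Subtype.ext ?_, fun r => Subtype.ext ?_⟩, ?_⟩⟩
  · refine Continuous.subtype_mk ((G.edge e).continuous.comp ?_) _
    exact Icc.continuous_convexComb_prod.comp (by fun_prop :
      Continuous fun p : I × I => (q p.2, q' p.2, p.1))
  · simp [h r]
  · simp [h' r]
  · rintro t r (rfl | rfl)
    · apply Subtype.ext
      have := h 0
      simp only [Path.source] at this
      simp [← h0, this]
    · apply Subtype.ext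
      have := h 1
      simp only [Path.target] at this
      simp [← h1, this]

/-- A path between vertices inside one edge is homotopic to a walk. -/
theorem Walk.exists_of_edge {M : Set E} {u v : V} (γ : Path (G.ptIn M u) (G.ptIn M v)) {e : E}
    {q : C(I, I)} (h : ∀ r, (γ r : X) = G.edge e (q r)) :
    ∃ w : G.Walk M u v, w.cls = .mk γ := by
  have h0 : G.edge e (q 0) = G.pt u := by rw [← h 0, γ.source]
  have h1 : G.edge e (q 1) = G.pt v := by rw [← h 1, γ.target]
  have hM : q 0 ≠ q 1 → e ∉ M := by
    intro hne he
    have hq : ∀ r, q r ≠ half := fun r => edge_mem_avoid.1 (h r ▸ (γ r).2) he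
    rcases G.edge_eq_pt h0 with ⟨h2, -⟩ | ⟨h2, -⟩ <;>
      rcases G.edge_eq_pt h1 with ⟨h3, -⟩ | ⟨h3, -⟩ <;>
      rcases side_of_ne_half q.continuous hq with hs | hs
    all_goals first
      | exact hne (h2.trans h3.symm)
      | exact (hs 0).not_gt (by rw [h2]; exact half_lt_one')
      | exact (hs 0).not_gt (by rw [h2]; exact half_pos')
      | exact (hs 1).not_gt (by rw [h3]; exact half_lt_one')
      | exact (hs 1).not_gt (by rw [h3]; exact half_pos')
  rcases G.edge_eq_pt h0 with ⟨h2, rfl⟩ | ⟨h2, rfl⟩ <;>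
    rcases G.edge_eq_pt h1 with ⟨h3, hv⟩ | ⟨h3, hv⟩
  · subst hv
    refine ⟨.nil _, Path.Homotopic.Quotient.eq.2 ?_⟩
    exact homotopic_of_edge (q := .const _ 0) (e := e) (fun r => by simp) h h2.symm h3.symm
  · subst hv
    have he := hM (by rw [h2, h3]; exact zero_ne_one)
    refine ⟨.cons (e, true) he rfl (.nil _), (Walk.cls_single (e, true) he).trans
      (Path.Homotopic.Quotient.eq.2 ?_)⟩
    exact homotopic_of_edge (q := .id _) (e := e) (fun r => rfl) h h2.symm h3.symm
  · subst hv
    have he := hM (by rw [h2, h3]; exact one_ne_zero)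
    refine ⟨.cons (e, false) he rfl (.nil _), (Walk.cls_single (e, false) he).trans
      (Path.Homotopic.Quotient.eq.2 ?_)⟩
    exact homotopic_of_edge (q := ⟨unitInterval.symm, unitInterval.continuous_symm⟩) (e := e)
      (fun r => rfl) h (by simp [h2]) (by simp [h3])
  · subst hv
    refine ⟨.nil _, Path.Homotopic.Quotient.eq.2 ?_⟩
    exact homotopic_of_edge (q := .const _ 1) (e := e) (fun r => by simp) h h2.symm h3.symm

/-- The homotopy of the unit interval that collapses the outer thirds to the ends. -/
noncomputable def squeeze (t s : I) : I :=
  Icc.convexComb s (projIcc 0 1 zero_le_one (3 * (s : ℝ) - 1)) t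

theorem continuous_squeeze : Continuous fun p : I × I => squeeze p.1 p.2 :=
  Icc.continuous_convexComb_prod.comp (by fun_prop : Continuous fun p : I × I =>
      (p.2, projIcc (0 : ℝ) 1 zero_le_one (3 * (p.2 : ℝ) - 1), p.1))

@[simp] theorem squeeze_zero_left (s : I) : squeeze 0 s = s := by simp [squeeze]

theorem squeeze_zero (t : I) : squeeze t 0 = 0 := by
  have : projIcc (0 : ℝ) 1 zero_le_one (3 * ((0 : I) : ℝ) - 1) = 0 :=
    projIcc_of_le_left _ (by norm_num)
  rw [squeeze, this]; ext; simp

theorem squeeze_one (t : I) : squeeze t 1 = 1 := by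
  have : projIcc (0 : ℝ) 1 zero_le_one (3 * ((1 : I) : ℝ) - 1) = 1 :=
    projIcc_of_right_le _ (by norm_num)
  rw [squeeze, this]; ext; simp

theorem squeeze_one_left_of_lt {s : I} (h : (s : ℝ) < 1 / 3) : squeeze 1 s = 0 := by
  rw [squeeze, Icc.convexComb_one]
  exact projIcc_of_le_left _ (by linarith)

theorem squeeze_one_left_of_gt {s : I} (h : 1 - (s : ℝ) < 1 / 3) : squeeze 1 s = 1 := by
  rw [squeeze, Icc.convexComb_one]
  exact projIcc_of_right_le _ (by linarith)

theorem squeeze_ne_half {t s : I} (h : s ≠ half) : squeeze t s ≠ half := by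
  intro hmid
  have ht := t.2.1
  have ht' := t.2.2
  have hmid' : (1 - (t : ℝ)) * s + t * max 0 (min 1 (3 * (s : ℝ) - 1)) = 1 / 2 := by
    have := congrArg Subtype.val hmid
    simpa [squeeze, projIcc] using this
  rcases lt_or_gt_of_ne h with h | h
  · have h1 : (s : ℝ) < 1 / 2 := h
    have h2 : max 0 (min 1 (3 * (s : ℝ) - 1)) < 1 / 2 :=
      max_lt (by norm_num) (min_lt_of_right_lt (by linarith))
    exact (convex_lt ht ht' h1 h2).ne hmid'
  · have h1 : 1 / 2 < (s : ℝ) := h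
    have h2 : 1 / 2 < max 0 (min 1 (3 * (s : ℝ) - 1)) :=
      lt_max_of_lt_right (lt_min (by norm_num) (by linarith))
    exact (lt_convex ht ht' h1 h2).ne' hmid'

/-- The homotopy of a graph that collapses the outer thirds of all edges to the vertices. -/
theorem exists_squeeze [T2Space X] : ∃ H : C(I × X, X), ∀ e t s,
    H (t, G.edge e s) = G.edge e (squeeze t s) :=
  G.exists_glue (fun e => ⟨fun p => G.edge e (squeeze p.1 p.2),
    (G.edge e).continuous.comp continuous_squeeze⟩) (fun v _ => G.pt v)
    (fun e a => by simp [squeeze_zero]) (fun e a => by simp [squeeze_one])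

/-- Every path between vertices that avoids the midpoints of `M` is homotopic, in the space avoiding
these midpoints, to an edge walk. After the outer thirds of the edges have been collapsed, the
pieces of a fine subdivision of the path either stay at a vertex or stay in one edge. -/
theorem Walk.exists_cls_eq_mk [T2Space X] {M : Set E} {u v : V}
    (p : Path (G.ptIn M u) (G.ptIn M v)) : ∃ w : G.Walk M u v, w.cls = .mk p := by
  obtain ⟨H, hH⟩ := exists_squeeze (G := G)
  have hHp : ∀ t v, H (t, G.pt v) = G.pt v := by
    intro t v
    obtain ⟨e, rfl | rfl⟩ := G.exists_endpoint v
    · simpa [squeeze_zero] using hH e t 0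
    · simpa [squeeze_one] using hH e t 1
  have hHM : ∀ t, ∀ x ∈ G.Avoid M, H (t, x) ∈ G.Avoid M := by
    intro t x hx
    obtain ⟨e, s, rfl⟩ := G.exists_edge x
    rw [hH, edge_mem_avoid]
    rw [edge_mem_avoid] at hx
    exact fun he => squeeze_ne_half (hx he)
  have hH0 : ∀ x, H (0, x) = x := by
    intro x
    obtain ⟨e, s, rfl⟩ := G.exists_edge x
    simp [hH]
  -- the squeezed path
  let p' : Path (G.ptIn M u) (G.ptIn M v) :=
    { toFun := fun r => ⟨H (1, p r), hHM 1 _ (p r).2⟩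
      continuous_toFun := by fun_prop
      source' := by simp [hHp]
      target' := by simp [hHp] }
  have hpp' : p.Homotopic p' := by
    refine ⟨⟨⟨⟨fun a => ⟨H (a.1, p a.2), hHM a.1 _ (p a.2).2⟩, by fun_prop⟩, fun r => ?_,
      fun r => rfl⟩, ?_⟩⟩
    · exact Subtype.ext (hH0 _)
    · rintro t r (rfl | rfl)
      · exact Subtype.ext (by simp [hHp])
      · exact Subtype.ext (by simp [hHp])
  rw [Path.Homotopic.Quotient.eq.2 hpp']
  -- a subdivision into pieces that are squeezed to a vertex or lie in an open edge
  let U : V ⊕ E → Set I := Sum.elim (fun v => {r | (p r : X) ∈ G.star v (1 / 3)})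
    fun e => {r | (p r : X) ∈ G.edge e '' Ioo 0 1}
  have hcont : Continuous fun r => (p r : X) := by fun_prop
  have hU : ∀ i, IsOpen (U i) := by
    rintro (v | e)
    · exact (G.isOpen_star (by norm_num) (by norm_num)).preimage hcont
    · exact (G.isOpen_edge_image e isOpen_Ioo subset_rfl).preimage hcont
  have hUc : univ ⊆ ⋃ i, U i := by
    intro r _
    rcases G.vertex_or_interior (p r : X) with ⟨v, hv⟩ | ⟨e, s, h0, h1, hs⟩
    · refine mem_iUnion.2 ⟨.inl v, ?_⟩
      change (p r : X) ∈ G.star v (1 / 3)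
      rw [hv]
      exact G.pt_mem_star v (by norm_num)
    · exact mem_iUnion.2 ⟨.inr e, s, ⟨h0, h1⟩, hs⟩
  obtain ⟨t, ht0, htm, ⟨m, htm1⟩, hts⟩ :=
    exists_monotone_Icc_subset_open_cover_unitInterval hU hUc
  -- up to each time of the subdivision, the path is homotopic to a walk followed by a path `γ` that
  -- stays in one edge
  have key : ∀ k, ∃ (n : V) (w : G.Walk M u n) (γ : Path (G.ptIn M n) (p' (t k))) (e : E)
      (q : C(I, I)), (∀ r, (γ r : X) = G.edge e (q r)) ∧
      (Path.Homotopic.Quotient.mk (p'.subpath 0 (t k))).cast p'.source.symm rfl =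
        w.cls.trans (.mk γ) := by
    intro k
    induction k with
    | zero =>
      obtain ⟨e, he⟩ := G.exists_endpoint u
      obtain ⟨s, hs⟩ : ∃ s, G.edge e s = G.pt u := by
        rcases he with rfl | rfl
        exacts [⟨0, by simp⟩, ⟨1, by simp⟩]
      refine ⟨u, .nil u, (Path.refl _).cast rfl (by rw [ht0]; exact p'.source), e, .const _ s,
        fun r => by simp [hs], ?_⟩
      rw [Walk.cls, Path.Homotopic.Quotient.refl_trans, ← Path.Homotopic.Quotient.mk_cast]
      congr 1
      ext r
      have h0 : Icc.convexComb 0 (t 0) r = 0 := by rw [ht0]; ext; simp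
      change (p' (Icc.convexComb 0 (t 0) r) : X) = G.pt u
      rw [h0, p'.source]
    | succ k ih =>
      obtain ⟨n, w, γ, e, q, hγ, hw⟩ := ih
      have hsplit : (Path.Homotopic.Quotient.mk (p'.subpath 0 (t (k + 1)))).cast p'.source.symm rfl
          = (w.cls.trans (.mk γ)).trans (.mk (p'.subpath (t k) (t (k + 1)))) := by
        rw [← hw]
        refine Path.Homotopic.Quotient.eq.2 ?_
        exact (Path.Homotopic.pathCast ⟨(Path.Homotopy.subpathTransSubpath p' 0 (t k)
          (t (k + 1)))⟩ p'.source.symm rfl).symm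
      -- extending the last piece inside its edge
      have merge : ∀ q' : C(I, I), q 1 = q' 0 → (∀ r, (p'.subpath (t k) (t (k + 1)) r : X) =
          G.edge e (q' r)) → ∃ (n : V) (w : G.Walk M u n) (γ : Path (G.ptIn M n) (p' (t (k + 1))))
          (e : E) (q : C(I, I)), (∀ r, (γ r : X) = G.edge e (q r)) ∧
          (Path.Homotopic.Quotient.mk (p'.subpath 0 (t (k + 1)))).cast p'.source.symm rfl =
            w.cls.trans (.mk γ) := by
        intro q' hqq hq'
        let Q : Path (q 0) (q' 1) := Path.trans ⟨q, rfl, rfl⟩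
          (Path.cast ⟨q', rfl, rfl⟩ hqq rfl)
        refine ⟨n, w, γ.trans (p'.subpath (t k) (t (k + 1))), e, Q, fun r => ?_, ?_⟩
        · simp only [Path.trans_apply, Q]
          change _ = G.edge e ((Path.trans _ _) r)
          rw [Path.trans_apply]
          split_ifs
          · exact hγ _
          · exact hq' _
        · rw [hsplit, Path.Homotopic.Quotient.trans_assoc, Path.Homotopic.Quotient.mk_trans]
      have hrange : ∀ r, ∃ r' ∈ Icc (t k) (t (k + 1)), p'.subpath (t k) (t (k + 1)) r = p' r' := by
        intro r
        have h := p'.range_subpath_of_le (t k) (t (k + 1)) (htm k.le_succ)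
        have h2 : p'.subpath (t k) (t (k + 1)) r ∈ p' '' Icc (t k) (t (k + 1)) := h ▸ ⟨r, rfl⟩
        obtain ⟨r', h3, h4⟩ := h2
        exact ⟨r', h3, h4.symm⟩
      have hsrc : G.edge e (q 1) = p' (t k) := by rw [← hγ 1, γ.target]
      obtain ⟨v' | e', hi⟩ := hts k
      · have hconst : ∀ r ∈ Icc (t k) (t (k + 1)), (p' r : X) = G.pt v' := by
          intro r hr
          obtain ⟨e', s, hs, h⟩ := hi hr
          change H (1, (p r : X)) = _
          rw [← hs, hH]
          rcases h with ⟨rfl, h⟩ | ⟨rfl, h⟩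
          · rw [squeeze_one_left_of_lt h, Path.source]
          · rw [squeeze_one_left_of_gt h, Path.target]
        refine merge (.const _ (q 1)) rfl fun r => ?_
        obtain ⟨r', hr', h⟩ := hrange r
        rw [h, hconst r' hr', ContinuousMap.const_apply, hsrc,
          hconst _ (left_mem_Icc.2 (htm k.le_succ))]
      · obtain ⟨q', hq'⟩ : ∃ q' : C(I, I), ∀ r, (p'.subpath (t k) (t (k + 1)) r : X) =
            G.edge e' (q' r) := by
          have hc : Continuous fun r => (p.subpath (t k) (t (k + 1)) r : X) := by fun_prop
          obtain ⟨q0, hq0⟩ := exists_edge_coord (e := e') hc (by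
            intro r
            have h := p.range_subpath_of_le (t k) (t (k + 1)) (htm k.le_succ)
            have h2 : p.subpath (t k) (t (k + 1)) r ∈ p '' Icc (t k) (t (k + 1)) := h ▸ ⟨r, rfl⟩
            obtain ⟨r', h3, h4⟩ := h2
            rw [← h4]
            exact hi h3)
          refine ⟨⟨fun r => squeeze 1 (q0 r), continuous_squeeze.comp (by fun_prop :
            Continuous fun r => ((1 : I), q0 r))⟩, fun r => ?_⟩
          change H (1, (p.subpath (t k) (t (k + 1)) r : X)) = G.edge e' (squeeze 1 (q0 r))
          rw [← (hq0 r).2, hH]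
        have hq0 : G.edge e (q 1) = G.edge e' (q' 0) := by
          rw [← hq' 0, hsrc, Path.source]
        by_cases hv : ∃ m, p' (t k) = G.ptIn M m
        · obtain ⟨m, hm⟩ := hv
          obtain ⟨w', hw'⟩ := Walk.exists_of_edge (γ.cast rfl hm.symm) (fun r => hγ r)
          refine ⟨m, w.append w', (p'.subpath (t k) (t (k + 1))).cast hm.symm rfl, e', q', hq', ?_⟩
          rw [hsplit, Walk.cls_append, hw', Path.Homotopic.Quotient.trans_assoc,
            Path.Homotopic.Quotient.trans_assoc]
          congr 1
        · by_cases hs : 0 < q 1 ∧ q 1 < 1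
          · obtain ⟨rfl, h⟩ := G.edge_inj _ _ _ _ hs.1 hs.2 hq0
            exact merge q' h hq'
          · exfalso
            apply hv
            by_cases h0 : q 1 = 0
            · exact ⟨G.src e, Subtype.ext (by rw [← hsrc, h0, Path.source])⟩
            · by_cases h1 : q 1 = 1
              · exact ⟨G.tgt e, Subtype.ext (by rw [← hsrc, h1, Path.target])⟩
              · exact absurd ⟨unitInterval.pos_iff_ne_zero.2 h0,
                  unitInterval.lt_one_iff_ne_one.2 h1⟩ hs
  obtain ⟨n, w, γ, e, q, hγ, hw⟩ := key m
  have h1 : p' (t m) = G.ptIn M v := by rw [htm1 m le_rfl, p'.target]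
  obtain ⟨w', hw'⟩ := Walk.exists_of_edge (γ.cast rfl h1.symm) (fun r => hγ r)
  refine ⟨w.append w', ?_⟩
  rw [Walk.cls_append, hw']
  have h2 : w.cls.trans (.mk (γ.cast rfl h1.symm)) = (w.cls.trans (.mk γ)).cast rfl h1.symm := by
    generalize w.cls = c
    obtain ⟨c⟩ := c
    rfl
  rw [h2, ← hw, Path.Homotopic.Quotient.cast_cast, ← Path.Homotopic.Quotient.mk_cast]
  congr 1
  ext r
  simp [htm1 m le_rfl, Path.subpath]

end TopGraph


/-! ### Free factors of free groups are malnormal -/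

namespace FreeGroup

variable {α : Type*}

theorem eq_of_mk_eq {L L' : List (α × Bool)} (hL : IsReduced L) (hL' : IsReduced L')
    (h : mk L = mk L') : L = L' := by
  classical
  rw [← hL.reduce_eq, ← hL'.reduce_eq]
  exact reduce.sound h

theorem isReduced_invRev {L : List (α × Bool)} (h : IsReduced L) : IsReduced (invRev L) := by
  classical
  apply IsReduced.of_reduce_eq
  rw [reduce_invRev, h.reduce_eq]

/-- A word `t` conjugating a nontrivial element spelled by letters outside `M` into an element
spelled by letters outside `M` has all its letters outside `M`. -/
theorem forall_notMem_of_conj {M : Set α} {t a b : List (α × Bool)} (ht : IsReduced t)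
    (ha : ∀ d ∈ a, d.1 ∉ M) (hb : ∀ d ∈ b, d.1 ∉ M) (ha1 : mk a ≠ 1)
    (h : mk a * mk t = mk t * mk b) : ∀ d ∈ t, d.1 ∉ M := by
  classical
  induction t generalizing a with
  | nil => simp
  | cons d t ih =>
    have hred : ∀ {L : List (α × Bool)}, (∀ d ∈ L, d.1 ∉ M) → ∀ d ∈ reduce L, d.1 ∉ M :=
      fun hL d hd => hL d ((Red.sublist reduce.red).subset hd)
    by_cases hd : d.1 ∈ M
    · -- a first letter `d` in `M` is impossible: the conjugate `t⁻¹ a t` would be reduced as it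
      -- stands, and contain `d`
      exfalso
      have hra : IsReduced (reduce a) := IsReduced.of_reduce_eq reduce.idem
      have hne : reduce a ≠ [] := by
        intro h0
        apply ha1
        rw [← reduce.self, h0, ← one_eq_mk]
      have h1 : IsReduced (reduce a ++ d :: t) := by
        refine List.isChain_append.2 ⟨hra, ht, fun x hx y hy hxy => ?_⟩
        have hx' := hred ha x (List.mem_of_mem_getLast? hx)
        simp only [List.head?_cons, Option.mem_some_iff] at hy
        rw [hxy, ← hy] at hx'
        exact absurd hd hx'
      have h2 : IsReduced (invRev (d :: t) ++ (reduce a ++ d :: t)) := by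
        refine List.isChain_append.2 ⟨isReduced_invRev ht, h1, fun x hx y hy hxy => ?_⟩
        have hx' : x.1 = d.1 := by
          simp [invRev] at hx
          rw [← hx]
        have hy' : y ∈ reduce a := by
          rw [List.head?_append_of_ne_nil _ hne] at hy
          exact List.mem_of_mem_head? hy
        exact absurd (hxy ▸ hx' ▸ hd) (hred ha y hy')
      have h3 : mk (invRev (d :: t) ++ (reduce a ++ d :: t)) = mk (reduce b) := by
        rw [← mul_mk, ← mul_mk, ← inv_mk, reduce.self, reduce.self, h, inv_mul_cancel_left]
      have h4 := eq_of_mk_eq h2 (IsReduced.of_reduce_eq reduce.idem) h3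
      exact hred hb d (h4 ▸ by simp) hd
    · have ht' : IsReduced t := ht.tail
      have hmk : mk (d :: t) = mk [d] * mk t := by rw [mul_mk]; rfl
      have := ih (a := invRev [d] ++ (a ++ [d])) ht' (by
          intro x hx
          simp only [invRev, List.mem_append] at hx
          rcases hx with hx | hx | hx
          · simp at hx; rw [hx]; exact hd
          · exact ha x hx
          · simp at hx; rw [hx]; exact hd) (by
          rw [← mul_mk, ← mul_mk, ← inv_mk]
          intro h1
          apply ha1
          have : mk a = mk [d] * ((mk [d])⁻¹ * (mk a * mk [d])) * (mk [d])⁻¹ := by group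
          rw [this, h1]; group) (by
          rw [← mul_mk, ← mul_mk, ← inv_mk]
          rw [hmk] at h
          rw [mul_assoc, mul_assoc, h, mul_assoc, inv_mul_cancel_left])
      intro x hx
      rcases List.mem_cons.1 hx with rfl | hx
      exacts [hd, this x hx]

end FreeGroup

namespace TopGraph

variable {X V E : Type*} [TopologicalSpace X] {G : TopGraph X V E}

/-! ### Reduced walks and the fundamental groupoid -/

theorem dartSrc_reverse (d : E × Bool) : G.dartSrc (d.1, !d.2) = G.dartTgt d := by
  obtain ⟨e, _ | _⟩ := d <;> rfl

theorem dartTgt_reverse (d : E × Bool) : G.dartTgt (d.1, !d.2) = G.dartSrc d := by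
  obtain ⟨e, _ | _⟩ := d <;> rfl

theorem dart_reverse (d : E × Bool) (s : I) :
    G.dart (d.1, !d.2) s = G.dart d (unitInterval.symm s) := by
  obtain ⟨e, _ | _⟩ := d
  · exact congrArg (G.edge e) (unitInterval.symm_symm s).symm
  · rfl

theorem dartCls_reverse {M : Set E} (d : E × Bool) (hd : d.1 ∉ M) :
    (dartCls (G := G) (M := M) (d.1, !d.2) hd).cast (congrArg (G.ptIn M) (dartSrc_reverse d).symm)
      (congrArg (G.ptIn M) (dartTgt_reverse d).symm) = (dartCls d hd).symm := by
  rw [dartCls, dartCls, ← Path.Homotopic.Quotient.mk_cast, ← Path.Homotopic.Quotient.mk_symm]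
  congr 1
  ext s
  exact dart_reverse d s

namespace Walk

theorem notMem_of_mem_word {M : Set E} {u v : V} (w : G.Walk M u v) :
    ∀ d ∈ w.word, d.1 ∉ M := by
  induction w with
  | nil => simp [word]
  | cons d hd hu w ih =>
    intro x hx
    rcases List.mem_cons.1 hx with rfl | hx
    exacts [hd, ih x hx]

theorem word_injective {M : Set E} {u v : V} (w w' : G.Walk M u v) (h : w.word = w'.word) :
    w = w' := by
  induction w with
  | nil => cases w' with
    | nil => rfl
    | cons => simp [word] at h
  | cons d hd hu w ih => cases w' with
    | nil => simp [word] at h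
    | cons d' hd' hu' w' =>
      obtain ⟨rfl, h2⟩ := List.cons.inj h
      rw [ih w' h2]

/-- Cancelling a letter against its inverse does not change the homotopy class of a walk. -/
theorem exists_reduced {M : Set E} {u v : V} (w : G.Walk M u v) :
    ∃ w' : G.Walk M u v, w'.cls = w.cls ∧ FreeGroup.IsReduced w'.word := by
  induction w with
  | nil v => exact ⟨.nil v, rfl, FreeGroup.IsReduced.nil⟩
  | @cons u v d hd hu w ih =>
    obtain ⟨w', h1, h2⟩ := ih
    have key : (cons d hd hu w').cls = (cons d hd hu w).cls := by rw [cls_cons, cls_cons, h1]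
    cases w' with
    | nil => exact ⟨_, key, FreeGroup.IsReduced.singleton⟩
    | cons d' hd' hu' w'' =>
      by_cases hr : d.1 = d'.1 → d.2 = d'.2
      · exact ⟨_, key, FreeGroup.isReduced_cons_cons.2 ⟨hr, h2⟩⟩
      · obtain ⟨h3, h4⟩ := Classical.not_imp.1 hr
        obtain rfl : d' = (d.1, !d.2) := Prod.ext h3.symm (Bool.eq_not_of_ne (Ne.symm h4))
        subst hu
        rw [← key, cls_cons, cls_cons, Path.Homotopic.Quotient.cast_rfl_rfl]
        have h8 : ∀ (x : V) (hx : G.dartTgt (d.1, !d.2) = x),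
            ∃ w3 : G.Walk M x v, w3.word = w''.word ∧
            ((dartCls (d.1, !d.2) hd').cast (congrArg (G.ptIn M) hu'.symm) rfl).trans w''.cls =
            ((dartCls (d.1, !d.2) hd').cast (congrArg (G.ptIn M) hu'.symm)
              (congrArg (G.ptIn M) hx.symm)).trans w3.cls := by
          rintro x rfl
          exact ⟨w'', rfl, rfl⟩
        obtain ⟨w3, h9, h10⟩ := h8 _ (dartTgt_reverse d)
        refine ⟨w3, ?_, h9 ▸ h2.tail⟩
        rw [h10, ← Path.Homotopic.Quotient.trans_assoc, dartCls_reverse,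
          Path.Homotopic.Quotient.trans_symm, Path.Homotopic.Quotient.refl_trans]

theorem exists_reduced_cls_eq [T2Space X] {M : Set E} {u v : V}
    (c : Path.Homotopic.Quotient (G.ptIn M u) (G.ptIn M v)) :
    ∃ w : G.Walk M u v, w.cls = c ∧ FreeGroup.IsReduced w.word := by
  obtain ⟨p⟩ := c
  obtain ⟨w, hw⟩ := exists_cls_eq_mk p
  obtain ⟨w', h, h'⟩ := w.exists_reduced
  exact ⟨w', h.trans hw, h'⟩

theorem exists_reduced_ofSubtype_eq [T2Space X] {u v : V}
    (c : Path.Homotopic.Quotient (G.pt u) (G.pt v)) :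
    ∃ w : G.Walk ∅ u v, w.cls.ofSubtype = c ∧ FreeGroup.IsReduced w.word := by
  obtain ⟨p⟩ := c
  obtain ⟨w, h, h'⟩ := exists_reduced_cls_eq (G := G) (M := ∅)
    (.mk (p.inSubtype (S := G.Avoid ∅) fun t e he => absurd he (notMem_empty e)))
  exact ⟨w, by rw [h]; rfl, h'⟩

/-- A walk whose letters are not in `N`, as a walk avoiding `N`. -/
theorem exists_of_notMem {M N : Set E} {u v : V} (w : G.Walk M u v) (h : ∀ d ∈ w.word, d.1 ∉ N) :
    ∃ w' : G.Walk N u v, w'.word = w.word ∧ w'.cls.ofSubtype = w.cls.ofSubtype := by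
  induction w with
  | nil v => exact ⟨.nil v, rfl, rfl⟩
  | @cons u v d hd hu w ih =>
    obtain ⟨w', h1, h2⟩ := ih fun x hx => h x (List.mem_cons_of_mem _ hx)
    refine ⟨.cons d (h d List.mem_cons_self) hu w', by simp [word, h1], ?_⟩
    rw [cls_cons, cls_cons, Path.Homotopic.Quotient.ofSubtype_trans,
      Path.Homotopic.Quotient.ofSubtype_trans, h2]
    rfl

/-- The class of a walk is represented by a path crossing only midpoints of edges of the walk. -/
theorem exists_path {M : Set E} {u v : V} (w : G.Walk M u v) :
    ∃ p : Path (G.pt u) (G.pt v), .mk p = w.cls.ofSubtype ∧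
      ∀ N : Set E, (∀ d ∈ w.word, d.1 ∉ N) → ∀ t, p t ∈ G.Avoid N := by
  induction w with
  | nil v => exact ⟨.refl _, rfl, fun N _ t => pt_mem_avoid N v⟩
  | @cons u v d hd hu w ih =>
    obtain ⟨p, h1, h2⟩ := ih
    refine ⟨((G.dart d).cast (by rw [hu]) rfl).trans p, ?_, fun N hN t => ?_⟩
    · rw [cls_cons, Path.Homotopic.Quotient.ofSubtype_trans, ← h1,
        Path.Homotopic.Quotient.mk_trans]
      rfl
    · rw [Path.trans_apply]
      split_ifs
      · exact dart_mem_avoid (hN d List.mem_cons_self) _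
      · exact h2 N (fun x hx => hN x (List.mem_cons_of_mem _ hx)) _

end Walk

/-- Every point is joined to a vertex by a path meeting no midpoint except possibly the point
itself. -/
theorem exists_path_from_vertex (G : TopGraph X V E) (y : X) :
    ∃ (n : V) (p : Path (G.pt n) y), ∀ M : Set E, y ∈ G.Avoid M → ∀ t, p t ∈ G.Avoid M := by
  obtain ⟨e, s, rfl⟩ := G.exists_edge y
  have key : ∀ a : I, (∀ t : I, Icc.convexComb a s t = half → s = half) →
      ∃ p : Path (G.edge e a) (G.edge e s),
        ∀ M : Set E, G.edge e s ∈ G.Avoid M → ∀ t, p t ∈ G.Avoid M := by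
    intro a ha
    refine ⟨⟨⟨fun t => G.edge e (Icc.convexComb a s t), (G.edge e).continuous.comp
      (Icc.continuous_convexComb_prod.comp (by fun_prop : Continuous fun t : I => (a, s, t)))⟩,
      by simp, by simp⟩, fun M hM t => ?_⟩
    rw [edge_mem_avoid] at hM
    exact edge_mem_avoid.2 fun he h => hM he (ha t h)
  have hcoe : ∀ {a t : I}, Icc.convexComb a s t = half →
      (1 - (t : ℝ)) * a + t * s = 1 / 2 := by
    intro a t h
    simpa using congrArg Subtype.val h
  rcases le_or_gt s half with h | h
  · obtain ⟨p, hp⟩ := key 0 (fun t ht => by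
      have h1 := hcoe ht
      have h2 : (s : ℝ) ≤ 1 / 2 := h
      have h3 := t.2.2
      have h4 := s.2.1
      simp only [Icc.coe_zero, mul_zero, zero_add] at h1
      exact Subtype.ext (le_antisymm h2 (by rw [coe_half]; nlinarith)))
    exact ⟨G.src e, p.cast (by simp) rfl, hp⟩
  · obtain ⟨p, hp⟩ := key 1 (fun t ht => by
      have h1 := hcoe ht
      have h2 : 1 / 2 < (s : ℝ) := h
      have h3 := t.2.2
      have h4 := t.2.1
      have h5 := s.2.2
      simp only [Icc.coe_one] at h1
      exfalso
      exact (lt_convex h4 h3 (by norm_num : (1 / 2 : ℝ) < 1) h2).ne' h1)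
    exact ⟨G.tgt e, p.cast (by simp) rfl, hp⟩

/-- Removing midpoints of edges does not destroy homotopies: paths avoiding the midpoints of `M`
that are homotopic are so through paths avoiding the midpoints of `M`, since both are determined by
their reduced words. -/
theorem ofSubtype_injective [T2Space X] {M : Set E} {a b : G.Avoid M}
    {c c' : Path.Homotopic.Quotient a b} (h : c.ofSubtype = c'.ofSubtype) : c = c' := by
  obtain ⟨m, p, hp⟩ := exists_path_from_vertex G a.1
  obtain ⟨n, q, hq⟩ := exists_path_from_vertex G b.1
  let P : Path.Homotopic.Quotient (G.ptIn M m) a := .mk (p.inSubtype (hp M a.2))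
  let Q : Path.Homotopic.Quotient (G.ptIn M n) b := .mk (q.inSubtype (hq M b.2))
  obtain ⟨w, hw, hwr⟩ := Walk.exists_reduced_cls_eq ((P.trans c).trans Q.symm)
  obtain ⟨w', hw', hwr'⟩ := Walk.exists_reduced_cls_eq ((P.trans c').trans Q.symm)
  have h1 : w.cls.ofSubtype = w'.cls.ofSubtype := by
    rw [hw, hw']
    simp only [Path.Homotopic.Quotient.ofSubtype_trans, h]
  obtain rfl := Walk.word_injective w w' (FreeGroup.eq_of_mk_eq hwr hwr' (Walk.mk_word_eq h1))
  have h2 : ∀ d : Path.Homotopic.Quotient a b,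
      d = (P.symm.trans ((P.trans d).trans Q.symm)).trans Q := by
    intro d
    simp only [Path.Homotopic.Quotient.trans_assoc, Path.Homotopic.Quotient.symm_trans,
      Path.Homotopic.Quotient.trans_refl]
    rw [← Path.Homotopic.Quotient.trans_assoc, Path.Homotopic.Quotient.symm_trans,
      Path.Homotopic.Quotient.refl_trans]
  rw [h2 c, h2 c', ← hw, hw']

/-- Every homotopy class of paths starting at a vertex has a representative that avoids all those
midpoints that can be avoided. -/
theorem exists_tight_path [T2Space X] {v : V} {y : X} (τ : Path.Homotopic.Quotient (G.pt v) y) :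
    ∃ T : Path (G.pt v) y, .mk T = τ ∧ ∀ (M : Set E) (hy : y ∈ G.Avoid M)
      (c : Path.Homotopic.Quotient (G.ptIn M v) ⟨y, hy⟩), c.ofSubtype = τ →
      ∀ t, T t ∈ G.Avoid M := by
  obtain ⟨n, p, hp⟩ := exists_path_from_vertex G y
  obtain ⟨w, hw, hwr⟩ := Walk.exists_reduced_ofSubtype_eq (τ.trans (.symm (.mk p)))
  obtain ⟨q, hq, hq'⟩ := w.exists_path
  refine ⟨q.trans p, ?_, fun M hy c hc t => ?_⟩
  · rw [Path.Homotopic.Quotient.mk_trans, hq, hw, Path.Homotopic.Quotient.trans_assoc,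
      Path.Homotopic.Quotient.symm_trans, Path.Homotopic.Quotient.trans_refl]
  · obtain ⟨w', hw', hwr'⟩ := Walk.exists_reduced_cls_eq
      (c.trans (.symm (.mk (p.inSubtype (hp M hy)))))
    have h1 : w.cls.ofSubtype = w'.cls.ofSubtype := by
      rw [hw, hw', Path.Homotopic.Quotient.ofSubtype_trans, hc]
      rfl
    have h2 := FreeGroup.eq_of_mk_eq hwr hwr' (Walk.mk_word_eq h1)
    rw [Path.trans_apply]
    split_ifs
    · exact hq' M (h2 ▸ w'.notMem_of_mem_word) _
    · exact hp M hy _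

/-- If a homotopy class `τ` conjugates an essential loop avoiding the midpoints of `M` to such a
loop, then `τ` itself can be represented by a path avoiding them. -/
theorem exists_ofSubtype_eq_of_conj [T2Space X] {M : Set E} {v : V} {y : X} (hy : y ∈ G.Avoid M)
    (τ : Path.Homotopic.Quotient (G.pt v) y)
    (a : Path.Homotopic.Quotient (G.ptIn M v) (G.ptIn M v))
    (b : Path.Homotopic.Quotient (⟨y, hy⟩ : G.Avoid M) ⟨y, hy⟩) (ha : a ≠ .refl _)
    (h : a.ofSubtype.trans τ = τ.trans b.ofSubtype) :
    ∃ c : Path.Homotopic.Quotient (G.ptIn M v) ⟨y, hy⟩, c.ofSubtype = τ := by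
  obtain ⟨n, p, hp⟩ := exists_path_from_vertex G y
  let P : Path.Homotopic.Quotient (G.ptIn M n) ⟨y, hy⟩ := .mk (p.inSubtype (hp M hy))
  obtain ⟨t, ht, htr⟩ := Walk.exists_reduced_ofSubtype_eq (τ.trans P.ofSubtype.symm)
  obtain ⟨wa, hwa, hwar⟩ := Walk.exists_reduced_cls_eq a
  obtain ⟨wb, hwb, -⟩ := Walk.exists_reduced_cls_eq ((P.trans b).trans P.symm)
  obtain ⟨wa', ha1, ha2⟩ := wa.exists_of_notMem (N := ∅) (by simp)
  obtain ⟨wb', hb1, hb2⟩ := wb.exists_of_notMem (N := ∅) (by simp)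
  have h1 : (wa'.append t).cls.ofSubtype = (t.append wb').cls.ofSubtype := by
    rw [Walk.cls_append, Walk.cls_append, Path.Homotopic.Quotient.ofSubtype_trans,
      Path.Homotopic.Quotient.ofSubtype_trans, ha2, hb2, hwa, hwb, ht,
      ← Path.Homotopic.Quotient.trans_assoc, h, Path.Homotopic.Quotient.ofSubtype_trans,
      Path.Homotopic.Quotient.ofSubtype_trans, Path.Homotopic.Quotient.ofSubtype_symm]
    simp only [Path.Homotopic.Quotient.trans_assoc]
    rw [← Path.Homotopic.Quotient.trans_assoc P.ofSubtype.symm,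
      Path.Homotopic.Quotient.symm_trans, Path.Homotopic.Quotient.refl_trans]
  have h2 := Walk.mk_word_eq h1
  rw [Walk.word_append, Walk.word_append, ← FreeGroup.mul_mk, ← FreeGroup.mul_mk, ha1, hb1] at h2
  have h3 : FreeGroup.mk wa.word ≠ 1 := by
    intro h3
    apply ha
    have h4 := FreeGroup.eq_of_mk_eq hwar FreeGroup.IsReduced.nil (h3.trans FreeGroup.one_eq_mk)
    rw [← hwa, Walk.word_injective wa (.nil v) h4, Walk.cls_nil]
  obtain ⟨t', -, ht'⟩ := t.exists_of_notMem (N := M) (FreeGroup.forall_notMem_of_conj htr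
    wa.notMem_of_mem_word wb.notMem_of_mem_word h3 h2)
  refine ⟨t'.cls.trans P, ?_⟩
  rw [Path.Homotopic.Quotient.ofSubtype_trans, ht', ht, Path.Homotopic.Quotient.trans_assoc,
    Path.Homotopic.Quotient.symm_trans, Path.Homotopic.Quotient.trans_refl]

end TopGraph


/-! ### Immersed loops follow cyclically reduced walks -/

/-- A continuous real function is not injective near a local extremum. -/
theorem not_isLocalExtr_of_injOn {f : ℝ → ℝ} {x : ℝ} {U : Set ℝ} (hU : U ∈ nhds x)
    (hf : ContinuousOn f U) (hinj : InjOn f U) : ¬ IsLocalExtr f x := by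
  have key : ∀ f : ℝ → ℝ, ContinuousOn f U → InjOn f U → ¬ IsLocalMax f x := by
    intro f hf hinj hmax
    obtain ⟨ε, hε, hball⟩ := Metric.mem_nhds_iff.1 (Filter.inter_mem hU hmax)
    rw [Real.ball_eq_Ioo] at hball
    have hx : x ∈ Ioo (x - ε) (x + ε) := ⟨by linarith, by linarith⟩
    have h1 : x - ε / 2 ∈ Ioo (x - ε) (x + ε) := ⟨by linarith, by linarith⟩
    have h2 : x + ε / 2 ∈ Ioo (x - ε) (x + ε) := ⟨by linarith, by linarith⟩
    have hsub : ∀ {a b}, a ∈ Ioo (x - ε) (x + ε) → b ∈ Ioo (x - ε) (x + ε) →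
        Icc a b ⊆ Ioo (x - ε) (x + ε) := fun ha hb => Icc_subset_Ioo ha.1 hb.2
    have hm1 : f (x - ε / 2) ≤ f x := (hball h1).2
    have hm2 : f (x + ε / 2) ≤ f x := (hball h2).2
    rcases le_total (f (x - ε / 2)) (f (x + ε / 2)) with h | h
    · obtain ⟨s, hs, hfs⟩ := intermediate_value_Icc (by linarith)
        (hf.mono ((hsub h1 hx).trans fun y hy => (hball hy).1)) ⟨h, hm2⟩
      have := hinj (hball (hsub h1 hx hs)).1 (hball h2).1 hfs
      linarith [hs.2]
    · obtain ⟨s, hs, hfs⟩ := intermediate_value_Icc' (by linarith)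
        (hf.mono ((hsub hx h2).trans fun y hy => (hball hy).1)) ⟨h, hm1⟩
      have := hinj (hball (hsub hx h2 hs)).1 (hball h1).1 hfs
      linarith [hs.1]
  rintro (h | h)
  · exact key (fun y => -f y) hf.neg (fun a ha b hb hab => hinj ha hb (neg_injective hab)) h.neg
  · exact key f hf hinj h

namespace TopGraph

variable {X V E : Type*} [TopologicalSpace X] {G : TopGraph X V E}

/-- The times at which a curve is at a vertex. -/
def vertexTimes (G : TopGraph X V E) (c : ℝ → X) : Set ℝ := {t | ∃ v, c t = G.pt v}

/-- Between the times `a` and `b` the curve `c` runs along the oriented edge `d`, from its initial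
to its terminal vertex. -/
def Traverses (G : TopGraph X V E) (c : ℝ → X) (a b : ℝ) (d : E × Bool) : Prop :=
  a < b ∧ ∃ F : ℝ → I, ContinuousOn F (Icc a b) ∧ F a = 0 ∧ F b = 1 ∧
    ∀ t ∈ Icc a b, c t = G.dart d (F t)

theorem Traverses.apply_left {c : ℝ → X} {a b : ℝ} {d : E × Bool} (h : G.Traverses c a b d) :
    c a = G.pt (G.dartSrc d) := by
  obtain ⟨hab, F, -, h0, -, hF⟩ := h
  rw [hF a (left_mem_Icc.2 hab.le), h0, Path.source]

theorem Traverses.apply_right {c : ℝ → X} {a b : ℝ} {d : E × Bool} (h : G.Traverses c a b d) :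
    c b = G.pt (G.dartTgt d) := by
  obtain ⟨hab, F, -, -, h1, hF⟩ := h
  rw [hF b (right_mem_Icc.2 hab.le), h1, Path.target]

theorem Traverses.add_period {c : ℝ → X} {a b T : ℝ} {d : E × Bool} (h : G.Traverses c a b d)
    (hT : Function.Periodic c T) : G.Traverses c (a + T) (b + T) d := by
  obtain ⟨hab, F, hFc, h0, h1, hF⟩ := h
  refine ⟨by linarith, fun t => F (t - T), hFc.comp (by fun_prop) fun t ht =>
    ⟨by linarith [ht.1], by linarith [ht.2]⟩, by simpa using h0, by simpa using h1, fun t ht => ?_⟩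
  rw [← hF _ ⟨by linarith [ht.1], by linarith [ht.2]⟩, hT.sub_eq]

/-- A locally injective curve does not backtrack. -/
theorem Traverses.no_backtrack {c : ℝ → X} (hi : IsLocallyInjective c) {a b b' : ℝ}
    {d d' : E × Bool} (h : G.Traverses c a b d) (h' : G.Traverses c b b' d') :
    d.1 = d'.1 → d.2 = d'.2 := by
  intro h1
  by_contra h2
  obtain rfl : d' = (d.1, !d.2) := Prod.ext h1.symm (Bool.eq_not_of_ne (Ne.symm h2))
  obtain ⟨hab, F, hFc, h0, h1, hF⟩ := h
  obtain ⟨hab', F', hFc', h0', h1', hF'⟩ := h'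
  -- in the coordinate of the edge, backtracking is a local maximum
  let f : ℝ → I := fun t => if t ≤ b then F t else unitInterval.symm (F' t)
  have hf : ∀ t ∈ Icc a b', c t = G.dart d (f t) := by
    intro t ht
    by_cases htb : t ≤ b
    · simp only [f, if_pos htb]
      exact hF t ⟨ht.1, htb⟩
    · simp only [f, if_neg htb]
      rw [hF' t ⟨(not_le.1 htb).le, ht.2⟩, dart_reverse]
  have hfc : ContinuousOn f (Icc a b') := by
    refine ContinuousOn.if ?_ ?_ ?_
    · rintro t ⟨-, ht⟩
      have : t = b := by
        have := frontier_Iic_subset (α := ℝ) b ht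
        simpa using this
      rw [this, h1, h0', unitInterval.symm_zero]
    · refine hFc.mono ?_
      rintro t ⟨ht, ht'⟩
      rw [show {t : ℝ | t ≤ b} = Iic b from rfl, closure_Iic] at ht'
      exact ⟨ht.1, ht'⟩
    · refine (unitInterval.continuous_symm.comp_continuousOn hFc').mono ?_
      rintro t ⟨ht, ht'⟩
      have : t ∈ Ici b := by
        have h3 : {t : ℝ | ¬ t ≤ b} = Ioi b := by ext; simp
        rwa [h3, closure_Ioi] at ht'
      exact ⟨this, ht.2⟩
  obtain ⟨U, hUo, hbU, hU⟩ := hi b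
  refine not_isLocalExtr_of_injOn (f := fun t => (f t : ℝ)) (x := b)
    (Filter.inter_mem (hUo.mem_nhds hbU) (Icc_mem_nhds hab hab'))
    ((continuous_subtype_val.comp_continuousOn hfc).mono inter_subset_right) ?_ (.inr ?_)
  · rintro s ⟨hs, hs'⟩ t ⟨ht, ht'⟩ hst
    exact hU hs ht (by rw [hf s hs', hf t ht', Subtype.ext hst])
  · refine Filter.Eventually.of_forall fun t => ?_
    simp only [f, le_refl, if_true, h1]
    exact unitInterval.le_one _

/-- If a curve runs inside an open edge until it reaches a vertex at time `a`, its edge coordinate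
converges to an end of the edge. -/
theorem exists_tendsto_end {c : ℝ → X} {a : ℝ} {l : Filter ℝ} {S : Set ℝ} {v : V} {e : E}
    {f : ℝ → I} (hc : Filter.Tendsto c l (nhds (c a))) (hv : c a = G.pt v)
    (hS : ∀ u ∈ l, ∃ U ⊆ u, U ∈ l ∧ _root_.IsPreconnected U ∧ U.Nonempty ∧ U ⊆ S)
    (hf : ContinuousOn f S) (hcf : ∀ t ∈ S, c t = G.edge e (f t)) :
    ∃ i : I, (i = 0 ∨ i = 1) ∧ G.edge e i = G.pt v ∧ Filter.Tendsto f l (nhds i) := by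
  have hSl : S ∈ l := by
    obtain ⟨U, -, h1, -, -, h2⟩ := hS _ Filter.univ_mem
    exact Filter.mem_of_superset h1 h2
  have hstar : ∀ δ : ℝ, 0 < δ → δ ≤ 1 → ∀ᶠ t in l, t ∈ S ∧
      ((G.src e = v ∧ (f t : ℝ) < δ) ∨ (G.tgt e = v ∧ 1 - (f t : ℝ) < δ)) := by
    intro δ h0 h1
    have h2 : G.star v δ ∈ nhds (c a) := (G.isOpen_star h0 h1).mem_nhds (hv ▸ G.pt_mem_star v h0)
    filter_upwards [hc h2, hSl] with t ht htS
    refine ⟨htS, (G.edge_mem_star h0 h1 e (f t)).1 ?_⟩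
    rw [← hcf t htS]
    exact ht
  obtain ⟨U, hU1, hU2, hU3, ⟨t0, ht0⟩, hU5⟩ := hS _ (hstar (1 / 2) (by norm_num) (by norm_num))
  have hne : ∀ t ∈ U, f t ≠ half := by
    intro t ht h
    rcases (hU1 ht).2 with ⟨-, h'⟩ | ⟨-, h'⟩
    · rw [h, coe_half] at h'; linarith
    · rw [h, coe_half] at h'; linarith
  have hpre := hU3.image f (hf.mono hU5)
  have hside : (∀ t ∈ U, f t < half) ∨ ∀ t ∈ U, half < f t := by
    by_contra hcon
    push Not at hcon
    obtain ⟨⟨a, ha, ha'⟩, ⟨b, hb, hb'⟩⟩ := hcon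
    obtain ⟨t, ht, h⟩ := hpre.Icc_subset (mem_image_of_mem f hb) (mem_image_of_mem f ha) ⟨hb', ha'⟩
    exact hne t ht h
  rcases hside with hs | hs
  · have hs' : ∀ t ∈ U, (f t : ℝ) < 1 / 2 := hs
    refine ⟨0, .inl rfl, ?_, ?_⟩
    · rcases (hU1 ht0).2 with ⟨h, -⟩ | ⟨-, h'⟩
      · rw [Path.source, h]
      · linarith [hs' t0 ht0]
    · rw [tendsto_subtype_rng, Metric.tendsto_nhds]
      intro ε hε
      filter_upwards [hstar (min ε (1 / 2)) (by positivity) (by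
        exact (min_le_right _ _).trans (by norm_num)), hU2] with t ht htU
      have h1 := hs' t htU
      have h2 := (f t).2.1
      rcases ht.2 with ⟨-, h⟩ | ⟨-, h⟩
      · rw [Icc.coe_zero, Real.dist_eq, sub_zero, abs_of_nonneg h2]
        exact h.trans_le (min_le_left _ _)
      · linarith [min_le_right ε (1 / 2 : ℝ)]
  · have hs' : ∀ t ∈ U, 1 / 2 < (f t : ℝ) := hs
    refine ⟨1, .inr rfl, ?_, ?_⟩
    · rcases (hU1 ht0).2 with ⟨-, h'⟩ | ⟨h, -⟩
      · linarith [hs' t0 ht0]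
      · rw [Path.target, h]
    · rw [tendsto_subtype_rng, Metric.tendsto_nhds]
      intro ε hε
      filter_upwards [hstar (min ε (1 / 2)) (by positivity) (by
        exact (min_le_right _ _).trans (by norm_num)), hU2] with t ht htU
      have h1 := hs' t htU
      have h2 := (f t).2.2
      rcases ht.2 with ⟨-, h⟩ | ⟨-, h⟩
      · linarith [min_le_right ε (1 / 2 : ℝ)]
      · rw [Icc.coe_one, Real.dist_eq, abs_sub_comm, abs_of_nonneg (by linarith)]
        exact h.trans_le (min_le_left _ _)

/-- A connected curve away from the vertices stays in one open edge and has a continuous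
coordinate there. -/
theorem exists_coord_of_no_vertex {c : ℝ → X} (hc : Continuous c) {S : Set ℝ}
    (hS : _root_.IsPreconnected S) {t₀ : ℝ} (ht₀ : t₀ ∈ S) (hno : ∀ t ∈ S, t ∉ G.vertexTimes c)
    {e : E} (he : c t₀ ∈ G.edge e '' Ioo 0 1) :
    ∃ f : ℝ → I, ContinuousOn f S ∧ ∀ t ∈ S, f t ∈ Ioo 0 1 ∧ c t = G.edge e (f t) := by
  have hopen : ∀ e, IsOpen (c ⁻¹' (G.edge e '' Ioo 0 1)) := fun e =>
    (G.isOpen_edge_image e isOpen_Ioo subset_rfl).preimage hc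
  have hsub : S ⊆ c ⁻¹' (G.edge e '' Ioo 0 1) := by
    refine hS.subset_left_of_subset_union (hopen e)
      (isOpen_iUnion fun e' => isOpen_iUnion fun _ : e' ≠ e => hopen e') ?_ ?_ ⟨t₀, ht₀, he⟩
    · rw [disjoint_left]
      rintro t ⟨s, hs, h⟩ ht
      simp only [mem_iUnion] at ht
      obtain ⟨e', hne, s', hs', h'⟩ := ht
      exact hne (G.edge_inj _ _ _ _ hs'.1 hs'.2 (h'.trans h.symm)).1
    · intro t ht
      rcases G.vertex_or_interior (c t) with h | ⟨e', s, h0, h1, h⟩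
      · exact absurd h (hno t ht)
      · by_cases hee : e' = e
        · exact .inl (hee ▸ ⟨s, ⟨h0, h1⟩, h⟩)
        · exact .inr (mem_iUnion₂.2 ⟨e', hee, s, ⟨h0, h1⟩, h⟩)
  obtain ⟨q, hq⟩ := exists_edge_coord (A := S) (c := fun t => c t) (e := e) (by fun_prop)
    fun t => hsub t.2
  classical
  refine ⟨fun t => if h : t ∈ S then q ⟨t, h⟩ else 0, ?_, fun t ht => ?_⟩
  · rw [continuousOn_iff_continuous_domRestrict]
    have : S.domRestrict (fun t => if h : t ∈ S then q ⟨t, h⟩ else 0) = q := by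
      ext t; simp
    rw [this]
    exact q.continuous
  · simp only [dif_pos ht]
    exact ⟨(hq ⟨t, ht⟩).1, (hq ⟨t, ht⟩).2.symm⟩

/-- Between two consecutive vertex times, a locally injective curve traverses an edge. -/
theorem exists_traverses {c : ℝ → X} (hc : Continuous c) (hi : IsLocallyInjective c) {a b : ℝ}
    (hab : a < b) (ha : a ∈ G.vertexTimes c) (hb : b ∈ G.vertexTimes c)
    (hno : ∀ t ∈ Ioo a b, t ∉ G.vertexTimes c) : ∃ d, G.Traverses c a b d := by
  obtain ⟨va, hva⟩ := ha
  obtain ⟨vb, hvb⟩ := hb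
  obtain ⟨t₀, ht₀⟩ : (Ioo a b).Nonempty := nonempty_Ioo.2 hab
  obtain ⟨e, he⟩ : ∃ e, c t₀ ∈ G.edge e '' Ioo 0 1 := by
    rcases G.vertex_or_interior (c t₀) with h | ⟨e, s, h0, h1, h⟩
    · exact absurd h (hno t₀ ht₀)
    · exact ⟨e, s, ⟨h0, h1⟩, h⟩
  obtain ⟨f, hfc, hf⟩ := exists_coord_of_no_vertex hc isPreconnected_Ioo ht₀ hno he
  obtain ⟨i, hi01, hie, hilim⟩ := exists_tendsto_end (l := nhdsWithin a (Ioi a)) (S := Ioo a b)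
    (hc.continuousAt.tendsto.mono_left nhdsWithin_le_nhds) hva (fun u hu => by
      obtain ⟨r, hr, hru⟩ := (mem_nhdsGT_iff_exists_Ioo_subset' hab).1 hu
      exact ⟨Ioo a (min r b), (Ioo_subset_Ioo_right (min_le_left _ _)).trans hru,
        Ioo_mem_nhdsGT (lt_min hr hab), isPreconnected_Ioo, nonempty_Ioo.2 (lt_min hr hab),
        Ioo_subset_Ioo_right (min_le_right _ _)⟩) hfc (fun t ht => (hf t ht).2)
  obtain ⟨j, hj01, hje, hjlim⟩ := exists_tendsto_end (l := nhdsWithin b (Iio b)) (S := Ioo a b)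
    (hc.continuousAt.tendsto.mono_left nhdsWithin_le_nhds) hvb (fun u hu => by
      obtain ⟨r, hr, hru⟩ := (mem_nhdsLT_iff_exists_Ioo_subset' hab).1 hu
      exact ⟨Ioo (max r a) b, (Ioo_subset_Ioo_left (le_max_left _ _)).trans hru,
        Ioo_mem_nhdsLT (max_lt hr hab), isPreconnected_Ioo, nonempty_Ioo.2 (max_lt hr hab),
        Ioo_subset_Ioo_left (le_max_right _ _)⟩) hfc (fun t ht => (hf t ht).2)
  -- a curve returning to the end it came from would turn around
  have hij : i ≠ j := by
    rintro rfl
    obtain ⟨t, ht, hext⟩ := exists_isLocalExtr_Ioo_of_tendsto (f := fun t => (f t : ℝ)) hab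
      (continuous_subtype_val.comp_continuousOn hfc)
      ((continuous_subtype_val.tendsto i).comp hilim)
      ((continuous_subtype_val.tendsto i).comp hjlim)
    obtain ⟨U, hUo, htU, hU⟩ := hi t
    refine not_isLocalExtr_of_injOn (Filter.inter_mem (hUo.mem_nhds htU)
      (Ioo_mem_nhds ht.1 ht.2)) ((continuous_subtype_val.comp_continuousOn hfc).mono
      inter_subset_right) ?_ hext
    rintro s ⟨hs, hs'⟩ r ⟨hr, hr'⟩ hsr
    exact hU hs hr (by rw [(hf s hs').2, (hf r hr').2, Subtype.ext hsr])
  let F : ℝ → I := fun t => if t = a then i else if t = b then j else f t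
  have hFa : F a = i := by simp [F]
  have hFb : F b = j := by simp [F, hab.ne']
  have hFf : ∀ t ∈ Ioo a b, F t = f t := fun t ht => by simp [F, ht.1.ne', ht.2.ne]
  have hcF : ∀ t ∈ Icc a b, c t = G.edge e (F t) := by
    intro t ht
    rcases eq_or_ne t a with rfl | hta
    · rw [hFa, hie, hva]
    rcases eq_or_ne t b with rfl | htb
    · rw [hFb, hje, hvb]
    have ht' : t ∈ Ioo a b := ⟨lt_of_le_of_ne ht.1 hta.symm, lt_of_le_of_ne ht.2 htb⟩
    rw [hFf t ht', (hf t ht').2]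
  have hFc : ContinuousOn F (Icc a b) := by
    have h1 : Filter.Tendsto F (nhdsWithin a (Ioi a)) (nhds (F a)) := by
      rw [hFa]
      refine hilim.congr' ?_
      filter_upwards [Ioo_mem_nhdsGT hab] with t ht using (hFf t ht).symm
    have h2 : Filter.Tendsto F (nhdsWithin b (Iio b)) (nhds (F b)) := by
      rw [hFb]
      refine hjlim.congr' ?_
      filter_upwards [Ioo_mem_nhdsLT hab] with t ht using (hFf t ht).symm
    intro t ht
    rcases eq_or_ne t a with rfl | hta
    · refine ((continuousWithinAt_Ioi_iff_Ici).1 h1).mono Icc_subset_Ici_self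
    rcases eq_or_ne t b with rfl | htb
    · refine ((continuousWithinAt_Iio_iff_Iic).1 h2).mono Icc_subset_Iic_self
    have ht' : t ∈ Ioo a b := ⟨lt_of_le_of_ne ht.1 hta.symm, lt_of_le_of_ne ht.2 htb⟩
    refine ContinuousAt.continuousWithinAt ?_
    refine (hfc.continuousAt (Ioo_mem_nhds ht'.1 ht'.2)).congr ?_
    filter_upwards [Ioo_mem_nhds ht'.1 ht'.2] with s hs using (hFf s hs).symm
  rcases hi01 with rfl | rfl <;> rcases hj01 with rfl | rfl
  · exact absurd rfl hij
  · exact ⟨(e, true), hab, F, hFc, hFa, hFb, hcF⟩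
  · refine ⟨(e, false), hab, fun t => unitInterval.symm (F t),
      unitInterval.continuous_symm.comp_continuousOn hFc, by simp [hFa], by simp [hFb],
      fun t ht => ?_⟩
    rw [hcF t ht]
    exact congrArg (G.edge e) (unitInterval.symm_symm _).symm
  · exact absurd rfl hij

end TopGraph

namespace TopGraph

variable {X V E : Type*} [TopologicalSpace X] {G : TopGraph X V E}

theorem eq_of_pt_mem_star {v w : V} (h : G.pt w ∈ G.star v 1) : w = v := by
  obtain ⟨e, rfl | rfl⟩ := G.exists_endpoint w
  · rw [← (G.edge e).source, edge_mem_star _ one_pos le_rfl] at h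
    rcases h with ⟨h, -⟩ | ⟨-, h⟩
    · exact h
    · norm_num at h
  · rw [← (G.edge e).target, edge_mem_star _ one_pos le_rfl] at h
    rcases h with ⟨-, h⟩ | ⟨h, -⟩
    · norm_num at h
    · exact h

/-- A locally injective curve is at a vertex only finitely often in bounded time. -/
theorem finite_vertexTimes {c : ℝ → X} (hc : Continuous c) (hi : IsLocallyInjective c) (s t : ℝ) :
    (G.vertexTimes c ∩ Icc s t).Finite := by
  have key : ∀ r, ∃ W ∈ nhds r, ∀ x ∈ W, x ∈ G.vertexTimes c → x = r := by
    intro r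
    rcases G.vertex_or_interior (c r) with ⟨v, hv⟩ | ⟨e, q, h0, h1, h⟩
    · obtain ⟨U, hUo, hr, hU⟩ := hi r
      refine ⟨U ∩ c ⁻¹' G.star v 1, Filter.inter_mem (hUo.mem_nhds hr)
        (((G.isOpen_star one_pos le_rfl).preimage hc).mem_nhds ?_), ?_⟩
      · rw [mem_preimage, hv]
        exact G.pt_mem_star v one_pos
      · rintro x ⟨hxU, hx⟩ ⟨w, hw⟩
        rw [mem_preimage, hw] at hx
        exact hU hxU hr (by rw [hw, eq_of_pt_mem_star hx, hv])
    · refine ⟨c ⁻¹' G.openEdges, (G.isOpen_openEdges.preimage hc).mem_nhds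
        (mem_iUnion.2 ⟨e, q, ⟨h0, h1⟩, h⟩), ?_⟩
      rintro x hx ⟨w, hw⟩
      obtain ⟨e', q', ⟨h0', h1'⟩, h'⟩ := mem_iUnion.1 hx
      exact absurd (h'.trans hw) (G.edge_ne_pt _ _ _ h0' h1')
  choose W hW hWr using key
  obtain ⟨T, -, hT⟩ := isCompact_Icc.elim_nhds_subcover (s := Icc s t) W fun x _ => hW x
  refine T.finite_toSet.subset ?_
  rintro x ⟨hx, hxI⟩
  obtain ⟨r, hr, hxr⟩ := mem_iUnion₂.1 (hT hxI)
  rw [hWr r x hxr hx]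
  exact hr

/-- Between two vertex times a locally injective curve follows a reduced walk. -/
theorem exists_walk_of_vertexTimes {c : ℝ → X} (hc : Continuous c) (hi : IsLocallyInjective c)
    {s t : ℝ} (hst : s < t) (hs : s ∈ G.vertexTimes c) (ht : t ∈ G.vertexTimes c) :
    ∃ (u v : V) (w : G.Walk ∅ u v), c s = G.pt u ∧ c t = G.pt v ∧ FreeGroup.IsReduced w.word ∧
      (∃ d ∈ w.word.head?, ∃ s', G.Traverses c s s' d) ∧
      ∃ d ∈ w.word.getLast?, ∃ t', G.Traverses c t' t d := by
  induction h : (G.vertexTimes c ∩ Ioo s t).ncard using Nat.strong_induction_on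
    generalizing s t with
  | _ n ih =>
    have hfin : ∀ s t, (G.vertexTimes c ∩ Ioo s t).Finite := fun s t =>
      (finite_vertexTimes hc hi s t).subset (inter_subset_inter_right _ Ioo_subset_Icc_self)
    rcases (G.vertexTimes c ∩ Ioo s t).eq_empty_or_nonempty with hemp | ⟨r, hrZ, hr⟩
    · obtain ⟨d, hd⟩ := exists_traverses hc hi hst hs ht fun r hr hrZ =>
        (hemp ▸ ⟨hrZ, hr⟩ : r ∈ (∅ : Set ℝ))
      exact ⟨_, _, .cons d (notMem_empty _) rfl (.nil _), hd.apply_left, hd.apply_right,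
        by simp [Walk.word],
        ⟨d, by simp [Walk.word], _, hd⟩, ⟨d, by simp [Walk.word], _, hd⟩⟩
    · obtain ⟨u, v, w, hu, hv, hw, hfirst, d, hd, t', hdt⟩ := ih _ (by
        rw [← h]
        refine ncard_lt_ncard ⟨fun x hx => ⟨hx.1, hx.2.1, hx.2.2.trans hr.2⟩, fun hsub => ?_⟩
          (hfin s t)
        exact (hsub ⟨hrZ, hr⟩).2.2.false) hr.1 hs hrZ rfl
      obtain ⟨u', v', w', hu', hv', hw', ⟨d', hd', s', hds⟩, hlast⟩ := ih _ (by
        rw [← h]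
        refine ncard_lt_ncard ⟨fun x hx => ⟨hx.1, hr.1.trans hx.2.1, hx.2.2⟩, fun hsub => ?_⟩
          (hfin s t)
        exact (hsub ⟨hrZ, hr⟩).2.1.false) hr.2 hrZ ht rfl
      obtain rfl : v = u' := G.pt_injective (hv.symm.trans hu')
      refine ⟨u, v', w.append w', hu, hv', ?_, ?_, ?_⟩
      · rw [Walk.word_append]
        refine List.isChain_append.2 ⟨hw, hw', fun x hx y hy => ?_⟩
        rw [Option.mem_def] at hx hy hd hd'
        obtain rfl : d = x := Option.some_injective _ (hd.symm.trans hx)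
        obtain rfl : d' = y := Option.some_injective _ (hd'.symm.trans hy)
        exact hdt.no_backtrack hi hds
      · obtain ⟨x, hx, hx'⟩ := hfirst
        refine ⟨x, ?_, hx'⟩
        rw [Walk.word_append, List.head?_append, Option.mem_def.1 hx]
        simp
      · obtain ⟨x, hx, hx'⟩ := hlast
        refine ⟨x, ?_, hx'⟩
        rw [Walk.word_append, List.getLast?_append, Option.mem_def.1 hx]
        simp

/-- A periodic locally injective curve that meets an open edge traverses it. -/
theorem exists_traverses_of_periodic {c : ℝ → X} (hc : Continuous c) (hi : IsLocallyInjective c)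
    {T : ℝ} (hT0 : 0 < T) (hT : Function.Periodic c T) {t₀ : ℝ} {e : E}
    (he : c t₀ ∈ G.edge e '' Ioo 0 1) : ∃ a b d, d.1 = e ∧ G.Traverses c a b d := by
  obtain ⟨z, hz⟩ : (G.vertexTimes c).Nonempty := by
    by_contra hno
    rw [not_nonempty_iff_eq_empty] at hno
    obtain ⟨f, hf, hfe⟩ := exists_coord_of_no_vertex (G := G) hc isPreconnected_univ
      (mem_univ t₀) (fun t _ => by rw [hno]; exact notMem_empty t) he
    have hfT : f 0 = f T := by
      refine (G.edge_inj e e _ _ (hfe 0 trivial).1.1 (hfe 0 trivial).1.2 ?_).2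
      rw [← (hfe 0 trivial).2, ← (hfe T trivial).2]
      simpa using (hT 0).symm
    have hf' : Continuous fun t => (f t : ℝ) :=
      continuous_subtype_val.comp (continuousOn_univ.1 hf)
    obtain ⟨r, -, hr⟩ := exists_isLocalExtr_Ioo hT0 hf'.continuousOn (congrArg Subtype.val hfT)
    obtain ⟨U, hUo, hrU, hU⟩ := hi r
    refine not_isLocalExtr_of_injOn (hUo.mem_nhds hrU) hf'.continuousOn ?_ hr
    intro x hx y hy hxy
    exact hU hx hy (by rw [(hfe x trivial).2, (hfe y trivial).2, Subtype.ext hxy])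
  have hshift : ∀ n : ℤ, z + n * T ∈ G.vertexTimes c := by
    intro n
    obtain ⟨v, hv⟩ := hz
    refine ⟨v, ?_⟩
    have h := (hT.int_mul n) z
    rw [← hv, ← h]
  obtain ⟨s, hs, hst⟩ : ∃ s ∈ G.vertexTimes c, s ≤ t₀ := by
    obtain ⟨n, hn⟩ := exists_int_lt ((t₀ - z) / T)
    refine ⟨_, hshift n, ?_⟩
    rw [lt_div_iff₀ hT0] at hn
    linarith
  obtain ⟨s', hs', hst'⟩ : ∃ s ∈ G.vertexTimes c, t₀ ≤ s := by
    obtain ⟨n, hn⟩ := exists_int_gt ((t₀ - z) / T)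
    refine ⟨_, hshift n, ?_⟩
    rw [div_lt_iff₀ hT0] at hn
    linarith
  have hne : t₀ ∉ G.vertexTimes c := by
    rintro ⟨v, hv⟩
    obtain ⟨q, ⟨h0, h1⟩, hq⟩ := he
    exact G.edge_ne_pt _ _ _ h0 h1 (hq.trans hv)
  obtain ⟨a, ⟨ha, has⟩, hamax⟩ := exists_max_image _ id (finite_vertexTimes (G := G) hc hi s t₀)
    ⟨s, hs, le_rfl, hst⟩
  obtain ⟨b, ⟨hb, hbs⟩, hbmin⟩ := exists_min_image _ id (finite_vertexTimes (G := G) hc hi t₀ s')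
    ⟨s', hs', hst', le_rfl⟩
  have hat : a < t₀ := lt_of_le_of_ne has.2 fun h => hne (h ▸ ha)
  have htb : t₀ < b := lt_of_le_of_ne hbs.1 fun h => hne (h ▸ hb)
  obtain ⟨d, hd⟩ := exists_traverses hc hi (hat.trans htb) ha hb fun t ht htZ => by
    rcases le_total t t₀ with h | h
    · exact (hamax t ⟨htZ, has.1.trans ht.1.le, h⟩).not_gt ht.1
    · exact (hbmin t ⟨htZ, h, ht.2.le.trans hbs.2⟩).not_gt ht.2
  refine ⟨a, b, d, ?_, hd⟩
  obtain ⟨-, F, -, -, -, hF⟩ := hd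
  obtain ⟨q, ⟨h0, h1⟩, hq⟩ := he
  have h := hq.trans (hF t₀ ⟨hat.le, htb.le⟩)
  rcases d with ⟨d, _ | _⟩
  · exact (G.edge_inj e d _ _ h0 h1 h).1.symm
  · exact (G.edge_inj e d _ _ h0 h1 h).1.symm

/-- Every end of an edge met by an immersed loop lies on a cyclically reduced closed walk. -/
theorem exists_isCyclicallyReduced_walk {γ : C(Circle, X)} (hγ : IsImmersedLoop γ) {z : Circle}
    {e : E} (he : γ z ∈ G.edge e '' Ioo 0 1) {v : V} (hv : G.src e = v ∨ G.tgt e = v) :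
    ∃ w : G.Walk ∅ v v, w.word ≠ [] ∧ FreeGroup.IsCyclicallyReduced w.word := by
  have hc : Continuous fun t => γ (Circle.exp t) := by fun_prop
  have hi : IsLocallyInjective fun t => γ (Circle.exp t) := by
    intro x
    obtain ⟨U, hUo, hxU, hU⟩ := hγ (Circle.exp x)
    refine ⟨Circle.exp ⁻¹' U ∩ Ioo (x - Real.pi) (x + Real.pi),
      (hUo.preimage Circle.exp.continuous).inter isOpen_Ioo,
      ⟨hxU, by linarith [Real.pi_pos], by linarith [Real.pi_pos]⟩, ?_⟩
    rintro s ⟨hs, hs'⟩ t ⟨ht, ht'⟩ hst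
    obtain ⟨m, hm⟩ := Circle.exp_eq_exp.1 (hU hs ht hst)
    have hpi := Real.pi_pos
    have h1 : (m : ℝ) < 1 := by
      by_contra hcon
      nlinarith [hs'.1, hs'.2, ht'.1, ht'.2]
    have h2 : (-1 : ℝ) < m := by
      by_contra hcon
      nlinarith [hs'.1, hs'.2, ht'.1, ht'.2]
    have : m = 0 := by
      have h1' : m < 1 := by exact_mod_cast h1
      have h2' : -1 < m := by exact_mod_cast h2
      omega
    rw [hm, this]; simp
  have hT : Function.Periodic (fun t => γ (Circle.exp t)) (2 * Real.pi) := fun t =>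
    congrArg γ (Circle.periodic_exp t)
  obtain ⟨t₀, rfl⟩ := Circle.exp_surjective z
  obtain ⟨a, b, d, hde, hd⟩ := exists_traverses_of_periodic hc hi Real.two_pi_pos hT he
  obtain ⟨t, ht⟩ : ∃ t, γ (Circle.exp t) = G.pt v := by
    have h1 := hd.apply_left
    have h2 := hd.apply_right
    subst hde
    rcases d with ⟨e, _ | _⟩ <;> rcases hv with rfl | rfl
    exacts [⟨_, h2⟩, ⟨_, h1⟩, ⟨_, h1⟩, ⟨_, h2⟩]
  obtain ⟨u, u', w, hu, hu', hw, ⟨d, hd, s', hds⟩, d', hd', t', hdt⟩ :=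
    exists_walk_of_vertexTimes (G := G) hc hi (lt_add_of_pos_right t Real.two_pi_pos)
    ⟨v, ht⟩ ⟨v, (hT t).trans ht⟩
  obtain rfl : v = u := G.pt_injective (ht.symm.trans hu)
  obtain rfl : v = u' := G.pt_injective (((hT t).trans ht).symm.trans hu')
  refine ⟨w, ?_, hw, fun x hx y hy => ?_⟩
  · rintro h
    simp [h] at hd
  · rw [Option.mem_def] at hx hy hd hd'
    obtain rfl : d' = x := Option.some_injective _ (hd'.symm.trans hx)
    obtain rfl : d = y := Option.some_injective _ (hd.symm.trans hy)
    exact hdt.no_backtrack hi (hds.add_period hT)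

end TopGraph

namespace TopGraph

variable {X V E : Type*} [TopologicalSpace X] {G : TopGraph X V E}

/-! ### Essential loops that avoid finitely many edges -/

theorem _root_.List.exists_eq_append_cons_of_exists_mem {α : Type*} {p : α → Prop} :
    ∀ {L : List α}, (∃ a ∈ L, p a) → ∃ A a B, L = A ++ a :: B ∧ p a ∧ ∀ b ∈ A, ¬ p b := by
  intro L
  induction L with
  | nil => rintro ⟨a, ha, -⟩; simp at ha
  | cons x L ih =>
    rintro ⟨a, ha, hpa⟩
    by_cases hx : p x
    · exact ⟨[], x, L, rfl, hx, by simp⟩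
    · obtain ⟨A, a', B, rfl, h1, h2⟩ := ih ⟨a, by
        rcases List.mem_cons.1 ha with rfl | h
        exacts [absurd hpa hx, h], hpa⟩
      exact ⟨x :: A, a', B, rfl, h1, by simpa [hx] using h2⟩

theorem Walk.exists_split {N : Set E} {u v : V} (w : G.Walk N u v) {A B : List (E × Bool)}
    {d : E × Bool} (h : w.word = A ++ d :: B) :
    ∃ (a : G.Walk N u (G.dartSrc d)) (b : G.Walk N (G.dartTgt d) v), a.word = A ∧ b.word = B := by
  induction w generalizing A with
  | nil v => simp [Walk.word] at h
  | cons d' hd hu w ih =>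
    subst hu
    cases A with
    | nil =>
      rw [Walk.word, List.nil_append, List.cons.injEq] at h
      obtain ⟨rfl, h⟩ := h
      exact ⟨.nil _, w, rfl, h⟩
    | cons x A =>
      rw [Walk.word, List.cons_append, List.cons.injEq] at h
      obtain ⟨rfl, h⟩ := h
      obtain ⟨a, b, ha, hb⟩ := ih h
      exact ⟨.cons d' hd rfl a, b, by rw [Walk.word, ha], hb⟩

theorem Walk.dartSrc_of_head? {N : Set E} {u v : V} (w : G.Walk N u v) {d : E × Bool}
    (h : d ∈ w.word.head?) : G.dartSrc d = u := by
  cases w with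
  | nil v => simp [Walk.word] at h
  | cons d' hd hu w =>
    obtain rfl : d' = d := by simpa [Walk.word] using h
    exact hu

theorem Walk.eq_of_word_eq_nil {N : Set E} {u v : V} (w : G.Walk N u v) (h : w.word = []) :
    v = u := by
  cases w with
  | nil v => rfl
  | cons d hd hu w => simp [Walk.word] at h

/-- Distinct reduced walks are not homotopic. -/
theorem Walk.word_eq_of_cls_eq {M : Set E} {u v : V} {w w' : G.Walk M u v}
    (hw : FreeGroup.IsReduced w.word) (hw' : FreeGroup.IsReduced w'.word) (h : w.cls = w'.cls) :
    w.word = w'.word :=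
  FreeGroup.eq_of_mk_eq hw hw' (Walk.mk_word_eq (congrArg _ h))

theorem _root_.Path.Homotopic.Quotient.trans_eq_of_trans_symm_trans_eq_refl {Y : Type*}
    [TopologicalSpace Y] {x y z : Y} {a : Path.Homotopic.Quotient x z}
    {q : Path.Homotopic.Quotient y z} {b : Path.Homotopic.Quotient y x}
    (h : (a.trans q.symm).trans b = .refl x) : b.trans a = q := by
  have h1 : b.trans a = (b.trans ((a.trans q.symm).trans b)).trans (b.symm.trans q) := by
    simp only [Path.Homotopic.Quotient.trans_assoc]
    rw [← Path.Homotopic.Quotient.trans_assoc b b.symm, Path.Homotopic.Quotient.trans_symm,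
      Path.Homotopic.Quotient.refl_trans, Path.Homotopic.Quotient.symm_trans,
      Path.Homotopic.Quotient.trans_refl]
  rw [h1, h, Path.Homotopic.Quotient.trans_refl, ← Path.Homotopic.Quotient.trans_assoc,
    Path.Homotopic.Quotient.trans_symm, Path.Homotopic.Quotient.refl_trans]

/-- If every vertex lies on a cyclically reduced closed walk, then for a finite set `M` of edges
all but finitely many vertices carry an essential loop that avoids `M`. Such a loop at `x` is the
closed walk itself, if it avoids `M`; otherwise the last and the first piece of it form a reduced
walk through `x` between ends of `M`, which is closed up by one of finitely many fixed walks. -/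
theorem finite_setOf_no_loop
    (hloop : ∀ v, ∃ w : G.Walk ∅ v v, w.word ≠ [] ∧ FreeGroup.IsCyclicallyReduced w.word)
    {M : Set E} (hM : M.Finite) :
    {v | ∀ a : Path.Homotopic.Quotient (G.ptIn M v) (G.ptIn M v), a = .refl _}.Finite := by
  classical
  let S : Set V := G.src '' M ∪ G.tgt '' M
  have hS : S.Finite := (hM.image _).union (hM.image _)
  have hsrc : ∀ d : E × Bool, d.1 ∈ M → G.dartSrc d ∈ S := by
    rintro ⟨e, _ | _⟩ he
    exacts [.inr ⟨e, he, rfl⟩, .inl ⟨e, he, rfl⟩]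
  have htgt : ∀ d : E × Bool, d.1 ∈ M → G.dartTgt d ∈ S := by
    rintro ⟨e, _ | _⟩ he
    exacts [.inl ⟨e, he, rfl⟩, .inr ⟨e, he, rfl⟩]
  -- the vertices of a chosen reduced walk from `u` to `v` that avoids `M`
  let Q : V → V → Set V := fun u v =>
    if h : ∃ q : G.Walk M u v, FreeGroup.IsReduced q.word then
      G.dartSrc '' {d | d ∈ h.choose.word} else ∅
  have hQ : ∀ u v, (Q u v).Finite := by
    intro u v
    by_cases h : ∃ q : G.Walk M u v, FreeGroup.IsReduced q.word
    · simp only [Q, dif_pos h]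
      exact (List.finite_toSet _).image _
    · simp only [Q, dif_neg h]
      exact finite_empty
  refine (hS.union (hS.biUnion fun u _ => hS.biUnion fun v _ => hQ u v)).subset fun x hx => ?_
  by_contra hxB
  rw [mem_union, not_or] at hxB
  obtain ⟨hxS, hxQ⟩ := hxB
  obtain ⟨w, hne, hw, hcyc⟩ := hloop x
  by_cases hav : ∀ d ∈ w.word, d.1 ∉ M
  · obtain ⟨w', hw', -⟩ := w.exists_of_notMem hav
    refine hne ?_
    rw [← hw']
    exact Walk.word_eq_of_cls_eq (w' := .nil x) (hw' ▸ hw) (by simp [Walk.word]) (hx _)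
  · push Not at hav
    obtain ⟨A, d, R, hA, hd, hAM⟩ := List.exists_eq_append_cons_of_exists_mem hav
    obtain ⟨B, d', R', hB, hd', hBM⟩ := List.exists_eq_append_cons_of_exists_mem
      (L := w.word.reverse) (p := fun d => d.1 ∈ M) (by simpa using hav)
    replace hB : w.word = R'.reverse ++ d' :: B.reverse := by
      rw [← List.reverse_inj, hB]; simp
    obtain ⟨a, -, ha, -⟩ := w.exists_split hA
    obtain ⟨-, b, -, hb⟩ := w.exists_split hB
    obtain ⟨a', ha', -⟩ := a.exists_of_notMem (N := M) (ha ▸ hAM)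
    obtain ⟨b', hb', -⟩ := b.exists_of_notMem (N := M) (by rw [hb]; simpa using hBM)
    rw [ha] at ha'
    rw [hb] at hb'
    -- `b'` followed by `a'` is a reduced walk through `x` from an end of `M` to an end of `M`
    have hp : FreeGroup.IsReduced (b'.append a').word := by
      rw [Walk.word_append, ha', hb']
      have h1 := hw
      have h2 := hw
      rw [hA] at h1
      rw [hB] at h2
      refine List.isChain_append.2 ⟨(List.isChain_append.1 h2).2.1.of_cons,
        (List.isChain_append.1 h1).1, fun y hy z hz => hcyc y ?_ z ?_⟩
      · rw [hB, List.getLast?_append, List.getLast?_cons, Option.mem_def.1 hy]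
        simp
      · rw [hA, List.head?_append, Option.mem_def.1 hz]
        simp
    have hex : ∃ q : G.Walk M (G.dartTgt d') (G.dartSrc d), FreeGroup.IsReduced q.word := ⟨_, hp⟩
    -- otherwise, following the one walk and then the other one back is an essential loop at `x`
    have hword : (b'.append a').word = hex.choose.word := by
      refine Walk.word_eq_of_cls_eq hp hex.choose_spec ?_
      have h := hx ((a'.cls.trans hex.choose.cls.symm).trans b'.cls)
      rw [Walk.cls_append]
      exact Path.Homotopic.Quotient.trans_eq_of_trans_symm_trans_eq_refl h
    refine hxQ (mem_biUnion (htgt d' hd') (mem_biUnion (hsrc d hd) ?_))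
    simp only [Q, dif_pos hex]
    cases hA' : A with
    | nil =>
      exact absurd (a'.eq_of_word_eq_nil (ha'.trans hA') ▸ hsrc d hd) hxS
    | cons y A' =>
      refine ⟨y, ?_, a'.dartSrc_of_head? (by simp [ha', hA'])⟩
      rw [mem_ofPred_eq, ← hword, Walk.word_append, ha', hA']
      simp

end TopGraph


/-! ### Core graphs as spaces glued from edges -/

section CW

open Topology Topology.RelCWComplex

variable {X : Type*} [TopologicalSpace X] [CWComplex (univ : Set X)]

/-- The characteristic map of a `1`-cell, parametrised by the unit interval. -/
noncomputable def edgeMap (e : cell (univ : Set X) 1) (s : I) : X := map 1 e fun _ => 2 * s - 1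

theorem edgeMap_mem_ball {s : I} (h0 : 0 < s) (h1 : s < 1) :
    (fun _ => 2 * (s : ℝ) - 1 : Fin 1 → ℝ) ∈ Metric.ball (0 : Fin 1 → ℝ) 1 := by
  have h0' : (0 : ℝ) < s := h0
  have h1' : (s : ℝ) < 1 := h1
  rw [mem_ball_zero_iff, pi_norm_lt_iff one_pos]
  intro _
  rw [Real.norm_eq_abs, abs_lt]
  constructor <;> linarith

theorem continuous_edgeMap (e : cell (univ : Set X) 1) : Continuous (edgeMap e) := by
  refine (RelCWComplex.continuousOn 1 e).comp_continuous (by fun_prop) fun s => ?_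
  have h0' : (0 : ℝ) ≤ s := s.2.1
  have h1' : (s : ℝ) ≤ 1 := s.2.2
  rw [mem_closedBall_zero_iff, pi_norm_le_iff_of_nonneg zero_le_one]
  intro _
  rw [Real.norm_eq_abs, abs_le]
  constructor <;> linarith

theorem image_edgeMap_Ioo (e : cell (univ : Set X) 1) :
    edgeMap e '' Ioo 0 1 = openCell 1 e := by
  ext x
  constructor
  · rintro ⟨s, hs, rfl⟩
    exact ⟨_, edgeMap_mem_ball hs.1 hs.2, rfl⟩
  · rintro ⟨y, hy, rfl⟩
    rw [mem_ball_zero_iff, pi_norm_lt_iff one_pos] at hy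
    have h := abs_lt.1 (hy 0)
    refine ⟨⟨(y 0 + 1) / 2, by linarith, by linarith⟩, ⟨?_, ?_⟩, ?_⟩
    · rw [← Subtype.coe_lt_coe]
      change (0 : ℝ) < (y 0 + 1) / 2
      linarith
    · rw [← Subtype.coe_lt_coe]
      change (y 0 + 1) / 2 < (1 : ℝ)
      linarith
    · rw [edgeMap]
      congr 1
      ext i
      rw [Subsingleton.elim i 0]
      change 2 * ((y 0 + 1) / 2) - 1 = y 0
      ring

theorem range_edgeMap (e : cell (univ : Set X) 1) : range (edgeMap e) = closedCell 1 e := by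
  ext x
  constructor
  · rintro ⟨s, rfl⟩
    refine ⟨_, ?_, rfl⟩
    have h0' : (0 : ℝ) ≤ s := s.2.1
    have h1' : (s : ℝ) ≤ 1 := s.2.2
    rw [mem_closedBall_zero_iff, pi_norm_le_iff_of_nonneg zero_le_one]
    intro _
    rw [Real.norm_eq_abs, abs_le]
    constructor <;> linarith
  · rintro ⟨y, hy, rfl⟩
    rw [mem_closedBall_zero_iff, pi_norm_le_iff_of_nonneg zero_le_one] at hy
    have h := abs_le.1 (hy 0)
    refine ⟨⟨(y 0 + 1) / 2, by linarith, by linarith⟩, ?_⟩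
    rw [edgeMap]
    congr 1
    ext i
    rw [Subsingleton.elim i 0]
    change 2 * ((y 0 + 1) / 2) - 1 = y 0
    ring

theorem exists_edgeMap_end (e : cell (univ : Set X) 1) {s : I} (hs : s = 0 ∨ s = 1) :
    ∃ v : cell (univ : Set X) 0, edgeMap e s = map 0 v ![] := by
  obtain ⟨x, y, h⟩ := CWComplex.exists_cellFrontier_one_eq e
  have hmem : edgeMap e s ∈ cellFrontier 1 e := by
    refine ⟨_, ?_, rfl⟩
    rw [mem_sphere_iff_norm, sub_zero, pi_norm_const]
    rcases hs with rfl | rfl <;> norm_num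
  rw [h, closedCell_zero_eq_singleton, closedCell_zero_eq_singleton] at hmem
  exact hmem.elim (fun h => ⟨x, h⟩) fun h => ⟨y, h⟩

theorem edgeMap_ne_map_zero {e : cell (univ : Set X) 1} {s : I} (h0 : 0 < s) (h1 : s < 1)
    (v : cell (univ : Set X) 0) : edgeMap e s ≠ map 0 v ![] := by
  intro h
  have h2 : edgeMap e s ∈ openCell 1 e := image_edgeMap_Ioo e ▸ ⟨s, ⟨h0, h1⟩, rfl⟩
  have h3 : edgeMap e s ∈ openCell 0 v := by rw [openCell_zero_eq_singleton, h]; rfl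
  have h4 := eq_of_not_disjoint_openCell (not_disjoint_iff.2 ⟨_, h2, h3⟩)
  exact absurd (congrArg Sigma.fst h4) one_ne_zero

theorem edgeMap_inj {e e' : cell (univ : Set X) 1} {s s' : I} (h0 : 0 < s) (h1 : s < 1)
    (h : edgeMap e s = edgeMap e' s') : e = e' ∧ s = s' := by
  have hs' : 0 < s' ∧ s' < 1 := by
    constructor
    · refine unitInterval.pos_iff_ne_zero.2 fun h2 => ?_
      obtain ⟨v, hv⟩ := exists_edgeMap_end e' (.inl h2)
      exact edgeMap_ne_map_zero h0 h1 v (h.trans hv)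
    · refine unitInterval.lt_one_iff_ne_one.2 fun h2 => ?_
      obtain ⟨v, hv⟩ := exists_edgeMap_end e' (.inr h2)
      exact edgeMap_ne_map_zero h0 h1 v (h.trans hv)
  have h2 : edgeMap e s ∈ openCell 1 e := image_edgeMap_Ioo e ▸ ⟨s, ⟨h0, h1⟩, rfl⟩
  have h3 : edgeMap e s ∈ openCell 1 e' := image_edgeMap_Ioo e' ▸ ⟨s', hs', h.symm⟩
  have h4 := eq_of_not_disjoint_openCell (not_disjoint_iff.2 ⟨_, h2, h3⟩)
  obtain rfl : e = e' := by simpa using h4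
  refine ⟨rfl, ?_⟩
  have h5 := (map 1 e).injOn (by rw [source_eq]; exact edgeMap_mem_ball h0 h1)
    (by rw [source_eq]; exact edgeMap_mem_ball hs'.1 hs'.2) h
  have h6 : 2 * (s : ℝ) - 1 = 2 * s' - 1 := congrFun h5 0
  exact Subtype.ext (by linarith)

/-- A subcomplex containing all immersed loops of a core graph is everything. -/
theorem IsCoreGraph.mem_subcomplex (hX : IsCoreGraph X)
    (Y : CWComplex.Subcomplex (univ : Set X))
    (hY : ∀ γ : C(Circle, X), IsImmersedLoop γ → range γ ⊆ (Y : Set X)) (x : X) :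
    x ∈ (Y : Set X) := by
  have hx : x ∈ graphCore X := by rw [show graphCore X = univ from hX]; trivial
  exact mem_iInter₂.1 hx Y hY

variable [LocallyFiniteConnectedGraph X]

theorem isClosed_of_edgeMap (A : Set X)
    (h : ∀ e : cell (univ : Set X) 1, IsClosed (edgeMap e ⁻¹' A)) : IsClosed A := by
  refine CWComplex.closed' A (subset_univ _) fun n (j : cell (univ : Set X) n) => ?_
  change IsClosed (A ∩ closedCell n j)
  match n, j with
  | 0, j =>
    rw [closedCell_zero_eq_singleton]
    exact ((finite_singleton _).subset inter_subset_right).isClosed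
  | 1, j =>
    rw [← range_edgeMap, ← image_preimage_eq_inter_range]
    exact ((h j).isCompact.image (continuous_edgeMap j)).isClosed
  | n + 2, j =>
    exact ((LocallyFiniteConnectedGraph.isEmpty_cell (n + 2) (by omega)).false j).elim

/-- In a core graph every vertex lies on an edge: an isolated vertex would be the whole graph, and
there is no immersed loop in a point. -/
theorem IsCoreGraph.exists_edgeMap_eq (hX : IsCoreGraph X) (x : X) :
    ∃ (e : cell (univ : Set X) 1) (s : I), edgeMap e s = x := by
  by_contra hcon
  push Not at hcon
  have hopen : IsClosed ({x}ᶜ : Set X) := isClosed_of_edgeMap _ fun e => by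
    rw [show edgeMap e ⁻¹' {x}ᶜ = univ from eq_univ_of_forall fun s => hcon e s]
    exact isClosed_univ
  have hclopen : IsClopen ({x} : Set X) := ⟨isClosed_singleton, by
    rwa [← isClosed_compl_iff]⟩
  have huniv : ({x} : Set X) = univ := hclopen.eq_univ (singleton_nonempty x)
  let Y : CWComplex.Subcomplex (univ : Set X) :=
    ⟨∅, fun _ => ∅, isClosed_empty, by simp⟩
  refine absurd (hX.mem_subcomplex Y (fun γ hγ => ?_) x) (notMem_empty x)
  obtain ⟨U, hUo, h1, hU⟩ := hγ 1
  have hsub : U ⊆ {1} := fun z hz => hU hz h1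
    (((huniv ▸ mem_univ (γ z) : γ z ∈ ({x} : Set X)) : γ z = x).trans
      ((huniv ▸ mem_univ (γ 1) : γ 1 ∈ ({x} : Set X)) : γ 1 = x).symm)
  have hone : IsClopen ({1} : Set Circle) := ⟨isClosed_singleton, by
    rwa [← hsub.antisymm (singleton_subset_iff.2 h1)]⟩
  have h2 : (Circle.exp Real.pi : Circle) ∈ ({1} : Set Circle) := by
    rw [hone.eq_univ (singleton_nonempty 1)]; trivial
  have h3 := congrArg (fun z : Circle => (z : ℂ)) (mem_singleton_iff.1 h2)
  simp only [Circle.coe_exp, Complex.exp_pi_mul_I, Circle.coe_one] at h3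
  norm_num at h3

/-- A core graph as a space glued from its edges, which are the `1`-cells. -/
theorem IsCoreGraph.exists_topGraph (hX : IsCoreGraph X) :
    ∃ G : TopGraph X (cell (univ : Set X) 0) (cell (univ : Set X) 1),
      ∀ e s, G.edge e s = edgeMap e s := by
  choose src hsrc using fun e : cell (univ : Set X) 1 => exists_edgeMap_end e (.inl rfl)
  choose tgt htgt using fun e : cell (univ : Set X) 1 => exists_edgeMap_end e (.inr rfl)
  exact ⟨{
    pt := fun v => map 0 v ![]
    src := src
    tgt := tgt
    edge := fun e => ⟨⟨edgeMap e, continuous_edgeMap e⟩, hsrc e, htgt e⟩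
    pt_injective := injective_map_zero (univ : Set X)
    edge_ne_pt := fun e s v h0 h1 => edgeMap_ne_map_zero h0 h1 v
    edge_inj := fun e e' s s' h0 h1 h => edgeMap_inj h0 h1 h
    exists_edge := hX.exists_edgeMap_eq
    isClosed_of_edge := isClosed_of_edgeMap
    finite_star := fun v => by
      refine (LocallyFiniteConnectedGraph.finite_edges v).subset fun e he => ?_
      rw [mem_ofPred_eq, closedCell_zero_eq_singleton, singleton_subset_iff, ← range_edgeMap]
      rcases he with rfl | rfl
      exacts [⟨0, hsrc e⟩, ⟨1, htgt e⟩] }, fun e s => rfl⟩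

/-- In a core graph every edge is met by an immersed loop, for otherwise removing it would leave a
smaller subgraph containing all immersed loops. -/
theorem IsCoreGraph.exists_isImmersedLoop (hX : IsCoreGraph X) (e : cell (univ : Set X) 1) :
    ∃ γ : C(Circle, X), IsImmersedLoop γ ∧ ∃ z, γ z ∈ openCell 1 e := by
  by_contra hcon
  push Not at hcon
  obtain ⟨G, hG⟩ := hX.exists_topGraph
  have hopen : IsOpen (openCell 1 e) := by
    rw [← image_edgeMap_Ioo, ← image_congr fun s _ => hG e s]
    exact G.isOpen_edge_image e isOpen_Ioo subset_rfl
  let Y : CWComplex.Subcomplex (univ : Set X) :=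
    ⟨(openCell 1 e)ᶜ, fun n => {j | (⟨n, j⟩ : Σ n, cell (univ : Set X) n) ≠ ⟨1, e⟩},
      hopen.isClosed_compl, by
        rw [empty_union]
        ext x
        simp only [mem_iUnion, mem_compl_iff]
        constructor
        · rintro ⟨n, ⟨j, hj⟩, hx⟩ hxe
          exact hj (eq_of_not_disjoint_openCell (not_disjoint_iff.2 ⟨x, hx, hxe⟩))
        · intro hx
          have hxu : x ∈ ⋃ (n : ℕ) (j : cell (univ : Set X) n), openCell n j := by
            rw [CWComplex.iUnion_openCell_eq_complex]; trivial
          simp only [mem_iUnion] at hxu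
          obtain ⟨n, j, hj⟩ := hxu
          refine ⟨n, ⟨j, ?_⟩, hj⟩
          rintro h
          cases h
          exact hx hj⟩
  obtain ⟨x, hx⟩ := openCell_nonempty 1 e
  refine absurd hx (hX.mem_subcomplex Y (fun γ hγ => ?_) x)
  rintro _ ⟨z, rfl⟩
  exact hcon γ hγ z

/-- A core graph is glued from edges in such a way that every vertex lies on a cyclically reduced
closed walk. -/
theorem IsCoreGraph.exists_topGraph_walk (hX : IsCoreGraph X) :
    ∃ G : TopGraph X (cell (univ : Set X) 0) (cell (univ : Set X) 1),
      ∀ v, ∃ w : G.Walk ∅ v v, w.word ≠ [] ∧ FreeGroup.IsCyclicallyReduced w.word := by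
  obtain ⟨G, hG⟩ := hX.exists_topGraph
  refine ⟨G, fun v => ?_⟩
  obtain ⟨e, hv⟩ := G.exists_endpoint v
  obtain ⟨γ, hγ, z, hz⟩ := hX.exists_isImmersedLoop e
  refine TopGraph.exists_isCyclicallyReduced_walk hγ (z := z) ?_ hv
  rwa [image_congr fun s _ => hG e s, image_edgeMap_Ioo]

end CW


/-! ### The tracks of the base points -/

section Natural

variable {X : Type*} [TopologicalSpace X]

theorem Path.Homotopic.Quotient.map_trans {Y : Type*} [TopologicalSpace Y] {x y z : X}
    (a : Path.Homotopic.Quotient x y) (b : Path.Homotopic.Quotient y z) (f : C(X, Y)) :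
    (a.trans b).map f = (a.map f).trans (b.map f) := by
  obtain ⟨a⟩ := a
  obtain ⟨b⟩ := b
  exact congrArg Path.Homotopic.Quotient.mk (Path.map_trans _ _ _)

theorem Path.Homotopic.Quotient.map_symm {Y : Type*} [TopologicalSpace Y] {x y : X}
    (a : Path.Homotopic.Quotient x y) (f : C(X, Y)) : a.symm.map f = (a.map f).symm := by
  obtain ⟨a⟩ := a
  rfl

/-- A map that is the identity on the fundamental group up to an inner automorphism admits a
homotopy class of paths from the base point to its image that intertwines loops and their
images. -/
theorem InducesIdentityInOut.exists_base_track [PathConnectedSpace X] {x₀ : X} {f : C(X, X)}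
    (hf : InducesIdentityInOut x₀ f) :
    ∃ τ : Path.Homotopic.Quotient x₀ (f x₀), ∀ γ : Path.Homotopic.Quotient x₀ x₀,
      γ.trans τ = τ.trans (γ.map f) := by
  obtain ⟨c, hc⟩ := hf
  let p : Path.Homotopic.Quotient x₀ (f x₀) := .mk (PathConnectedSpace.somePath x₀ (f x₀))
  let c' : Path.Homotopic.Quotient x₀ x₀ := c
  have key : ∀ γ : Path.Homotopic.Quotient x₀ x₀,
      p.trans ((γ.map f).trans p.symm) = c'.symm.trans (γ.trans c') := fun γ =>
    DFunLike.congr_fun hc γ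
  refine ⟨c'.trans p, fun γ => ?_⟩
  have h := congrArg (fun q => (c'.trans q).trans p) (key γ)
  simp only [Path.Homotopic.Quotient.trans_assoc, Path.Homotopic.Quotient.symm_trans,
    Path.Homotopic.Quotient.trans_refl] at h
  rw [← Path.Homotopic.Quotient.trans_assoc c' c'.symm, Path.Homotopic.Quotient.trans_symm,
    Path.Homotopic.Quotient.refl_trans] at h
  rw [Path.Homotopic.Quotient.trans_assoc]
  exact h.symm

/-- A map that is the identity on the fundamental group up to an inner automorphism is naturally
isomorphic to the identity on the fundamental groupoid. -/
theorem InducesIdentityInOut.exists_track [PathConnectedSpace X] {x₀ : X} {f : C(X, X)}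
    (hf : InducesIdentityInOut x₀ f) :
    ∃ τ : ∀ x, Path.Homotopic.Quotient x (f x), ∀ x y (q : Path.Homotopic.Quotient x y),
      q.trans (τ y) = (τ x).trans (q.map f) := by
  obtain ⟨τ₀, hτ₀⟩ := hf.exists_base_track
  let δ : ∀ x, Path.Homotopic.Quotient x₀ x := fun x => .mk (PathConnectedSpace.somePath x₀ x)
  refine ⟨fun x => (δ x).symm.trans (τ₀.trans ((δ x).map f)), fun x y q => ?_⟩
  have h := hτ₀ (((δ x).trans q).trans (δ y).symm)
  rw [Path.Homotopic.Quotient.map_trans, Path.Homotopic.Quotient.map_trans,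
    Path.Homotopic.Quotient.map_symm] at h
  have h' := congrArg (fun c => (δ x).symm.trans (c.trans ((δ y).map f))) h
  simp only [Path.Homotopic.Quotient.trans_assoc, Path.Homotopic.Quotient.symm_trans,
    Path.Homotopic.Quotient.trans_refl] at h'
  rw [← Path.Homotopic.Quotient.trans_assoc (δ x).symm (δ x), Path.Homotopic.Quotient.symm_trans,
    Path.Homotopic.Quotient.refl_trans] at h'
  simp only [Path.Homotopic.Quotient.trans_assoc]
  exact h'

end Natural

namespace TopGraph

variable {X V E : Type*} [TopologicalSpace X] {G : TopGraph X V E}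

/-- A walk avoiding `N` is represented by a path which, away from vertices of the walk, runs in
edges outside `N`. -/
theorem Walk.exists_path_in_edges {N : Set E} {u v : V} (w : G.Walk N u v) :
    ∃ p : Path (G.pt u) (G.pt v), .mk p = w.cls.ofSubtype ∧
      ∀ t, p t = G.pt v ∨ ∃ e s, e ∉ N ∧ p t = G.edge e s := by
  induction w with
  | nil v => exact ⟨.refl _, rfl, fun t => .inl rfl⟩
  | @cons u v d hd hu w ih =>
    subst hu
    obtain ⟨p, hp, hp'⟩ := ih
    refine ⟨(G.dart d).trans p, ?_, fun t => ?_⟩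
    · rw [Walk.cls_cons, Path.Homotopic.Quotient.mk_trans, hp,
        Path.Homotopic.Quotient.ofSubtype_trans]
      rfl
    · rw [Path.trans_apply]
      split_ifs
      · rcases d with ⟨d, _ | _⟩
        · exact .inr ⟨d, _, hd, rfl⟩
        · exact .inr ⟨d, _, hd, rfl⟩
      · exact hp' _

theorem finite_setOf_pt_mem {K : Set X} (hK : IsCompact K) : {v | G.pt v ∈ K}.Finite := by
  have hN := G.finite_meets_compact hK
  refine ((hN.image G.src).union (hN.image G.tgt)).subset fun v hv => ?_
  obtain ⟨e, rfl | rfl⟩ := G.exists_endpoint v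
  · exact .inl ⟨e, ⟨_, ⟨0, (G.edge e).source⟩, hv⟩, rfl⟩
  · exact .inr ⟨e, ⟨_, ⟨1, (G.edge e).target⟩, hv⟩, rfl⟩

theorem isCompact_mids (G : TopGraph X V E) {M : Set E} (hM : M.Finite) :
    IsCompact ((fun e => G.edge e half) '' M) :=
  (hM.image _).isCompact

/-- For a proper map `f`, natural homotopy classes of paths `τ x` from `x` to `f x` avoid a given
finite set of midpoints at all but finitely many vertices: away from a finite set there are essential loops
that, together with their images, stay away from these midpoints, and `τ` conjugates one into the
other. -/
theorem finite_setOf_track_not_avoid [T2Space X]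
    (hloop : ∀ v, ∃ w : G.Walk ∅ v v, w.word ≠ [] ∧ FreeGroup.IsCyclicallyReduced w.word)
    {f : C(X, X)} (hf : IsProperMap f) {τ : ∀ x, Path.Homotopic.Quotient x (f x)}
    (hτ : ∀ x y (q : Path.Homotopic.Quotient x y), q.trans (τ y) = (τ x).trans (q.map f))
    {M : Set E} (hM : M.Finite) :
    {v | ∀ (hy : f (G.pt v) ∈ G.Avoid M) (c : Path.Homotopic.Quotient (G.ptIn M v) ⟨_, hy⟩),
      c.ofSubtype ≠ τ (G.pt v)}.Finite := by
  have hK := hf.isCompact_preimage (G.isCompact_mids hM)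
  set K : Set X := f ⁻¹' ((fun e => G.edge e half) '' M) with hKdef
  have hKM : ∀ x, x ∉ K → f x ∈ G.Avoid M := fun x hx e he h => hx ⟨e, he, h.symm⟩
  have hN := G.finite_meets_compact hK
  refine ((finite_setOf_no_loop hloop (hM.union hN)).union
    (finite_setOf_pt_mem (G := G) hK)).subset fun v hv => ?_
  by_contra hcon
  rw [mem_union, not_or] at hcon
  obtain ⟨hcon, hvK⟩ := hcon
  rw [mem_ofPred_eq] at hcon
  push Not at hcon
  obtain ⟨a, ha⟩ := hcon
  obtain ⟨w, rfl, -⟩ := Walk.exists_reduced_cls_eq a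
  obtain ⟨p, hp, hpe⟩ := w.exists_path_in_edges
  have hfp : ∀ t, f (p t) ∈ G.Avoid M := by
    intro t
    refine hKM _ fun ht => ?_
    rcases hpe t with h | ⟨e, s, he, h⟩
    · exact hvK (show G.pt v ∈ K from h ▸ ht)
    · exact he (.inr ⟨_, ⟨s, h.symm⟩, ht⟩)
  obtain ⟨w', -, hw'⟩ := w.exists_of_notMem (N := M) fun d hd hdM =>
    w.notMem_of_mem_word d hd (.inl hdM)
  have ha' : w'.cls ≠ .refl _ := fun h => ha (ofSubtype_injective (by
    rw [← hw', h]
    rfl))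
  have hy : f (G.pt v) ∈ G.Avoid M := hKM _ hvK
  obtain ⟨c, hc⟩ := exists_ofSubtype_eq_of_conj hy (τ (G.pt v)) w'.cls
    (.mk ((p.map f.continuous).inSubtype hfp)) ha' (by
      rw [hw', ← hp]
      exact hτ _ _ _)
  exact hv hy c hc

end TopGraph


/-! ### Filling squares -/

theorem Path.trans_apply_of_eq_half {Y : Type*} [TopologicalSpace Y] {x y z : Y} (p : Path x y)
    (q : Path y z) {c s : I} (h : (c : ℝ) = s / 2) : (p.trans q) c = p s := by
  rw [Path.trans_apply, dif_pos (by linarith [s.2.2])]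
  congr 1
  exact Subtype.ext (by change 2 * (c : ℝ) = s; linarith)

theorem Path.trans_apply_of_eq_half_add {Y : Type*} [TopologicalSpace Y] {x y z : Y} (p : Path x y)
    (q : Path y z) {c s : I} (h : (c : ℝ) = (s + 1) / 2) : (p.trans q) c = q s := by
  rw [Path.trans_apply]
  split_ifs with hc
  · have hs : s = 0 := Subtype.ext (by change (s : ℝ) = 0; linarith [s.2.1])
    rw [hs, q.source, show (⟨2 * (c : ℝ), _⟩ : I) = 1 from
      Subtype.ext (by change 2 * (c : ℝ) = 1; rw [h, hs]; simp), p.target]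
  · congr 1
    exact Subtype.ext (by change 2 * (c : ℝ) - 1 = s; linarith)

/-- Two homotopic concatenations of two paths are the two halves of the boundary of a square. -/
theorem Path.Homotopic.exists_square {Y : Type*} [TopologicalSpace Y] {x y w z : Y} {p : Path x y}
    {q : Path y z} {p' : Path x w} {q' : Path w z} (h : (p.trans q).Homotopic (p'.trans q')) :
    ∃ g : C(I × I, Y), (∀ s, g (0, s) = p s) ∧ (∀ r, g (r, 1) = q r) ∧ (∀ r, g (r, 0) = p' r) ∧
      ∀ s, g (1, s) = q' s := by
  obtain ⟨F⟩ := h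
  -- The square is collapsed to the domain of the homotopy: `ρ` is the time along the paths, and the
  -- homotopy parameter `u`, undefined at two corners, is `0` on one half of the boundary and `1` on
  -- the other.
  let ρ : I × I → I := fun z => ⟨((z.1 : ℝ) + z.2) / 2, by
    constructor <;> linarith [z.1.2.1, z.1.2.2, z.2.2.1, z.2.2.2]⟩
  have hρ : Continuous ρ := by fun_prop
  let a : I × I → ℝ := fun z => z.1 * (1 - z.2)
  let b : I × I → ℝ := fun z => z.2 * (1 - z.1)
  have ha : ∀ z, 0 ≤ a z := fun z => mul_nonneg z.1.2.1 (sub_nonneg.2 z.2.2.2)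
  have hb : ∀ z, 0 ≤ b z := fun z => mul_nonneg z.2.2.1 (sub_nonneg.2 z.1.2.2)
  let u : I × I → I := fun z => projIcc 0 1 zero_le_one (a z / (a z + b z))
  let g : I × I → Y := fun z => F (u z, ρ z)
  have hF0 : ∀ t, F (t, 0) = x := fun t => F.source t
  have hF1 : ∀ t, F (t, 1) = z := fun t => F.target t
  -- at the two corners continuity holds because the homotopy is constant there
  have hcorner : ∀ (c : I × I) (y₀ : Y), (∀ t, F (t, ρ c) = y₀) → ContinuousAt g c := by
    intro c y₀ hc
    have hgc : g c = y₀ := hc _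
    rw [ContinuousAt, hgc]
    intro W hW
    have h1 : ∀ᶠ r in nhds (ρ c), ∀ t ∈ (univ : Set I), F (t, r) ∈ W :=
      isCompact_univ.eventually_forall_of_forall_eventually fun t _ => by
        have h2 : Continuous fun z : I × I => F (z.2, z.1) := by fun_prop
        refine h2.continuousAt.eventually_mem ?_
        rw [hc t]
        exact hW
    change g ⁻¹' W ∈ nhds c
    filter_upwards [hρ.continuousAt.eventually h1] with d hd
    exact hd _ trivial
  have hab : ∀ c, a c = 0 → b c = 0 → ρ c = 0 ∨ ρ c = 1 := by
    intro c ha0 hb0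
    rcases mul_eq_zero.1 ha0 with h1 | h1
    · have h2 : (c.2 : ℝ) = 0 := by
        rcases mul_eq_zero.1 hb0 with h | h
        · exact h
        · linarith
      exact .inl (Subtype.ext (by change ((c.1 : ℝ) + c.2) / 2 = 0; rw [h1, h2]; norm_num))
    · have h2 : (c.1 : ℝ) = 1 := by
        rcases mul_eq_zero.1 hb0 with h | h <;> linarith
      have h3 : (c.2 : ℝ) = 1 := by linarith
      exact .inr (Subtype.ext (by change ((c.1 : ℝ) + c.2) / 2 = 1; rw [h2, h3]; norm_num))
  have hg : Continuous g := by
    rw [continuous_iff_continuousAt]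
    intro c
    by_cases h0 : a c + b c = 0
    · rcases hab c (le_antisymm (by linarith [hb c]) (ha c))
        (le_antisymm (by linarith [ha c]) (hb c)) with h | h
      · exact hcorner c x fun t => by rw [h, hF0]
      · exact hcorner c z fun t => by rw [h, hF1]
    · have h1 : ContinuousAt (fun z => a z / (a z + b z)) c :=
        ContinuousAt.div (by fun_prop) (by fun_prop) h0
      exact F.continuous.continuousAt.comp
        ((continuous_projIcc.continuousAt.comp h1).prodMk hρ.continuousAt)
  have hu0 : ∀ c, a c = 0 → u c = 0 := by
    intro c hc
    change projIcc (0 : ℝ) 1 _ _ = _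
    rw [hc, zero_div, projIcc_left]
    rfl
  have hu1 : ∀ c, b c = 0 → a c ≠ 0 → u c = 1 := by
    intro c hc hc'
    change projIcc (0 : ℝ) 1 _ _ = _
    rw [hc, add_zero, div_self hc', projIcc_right]
    rfl
  have hleft : ∀ c, a c = 0 → g c = (p.trans q) (ρ c) := by
    intro c hc
    change F (u c, ρ c) = _
    rw [hu0 c hc, F.apply_zero]
    rfl
  have hright : ∀ c, b c = 0 → g c = (p'.trans q') (ρ c) := by
    intro c hc
    by_cases hc' : a c = 0
    · change F (u c, ρ c) = _
      rcases hab c hc' hc with h | h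
      · rw [h, hF0, Path.source]
      · rw [h, hF1, Path.target]
    · change F (u c, ρ c) = _
      rw [hu1 c hc hc', F.apply_one]
      rfl
  refine ⟨⟨g, hg⟩, fun s => ?_, fun r => ?_, fun r => ?_, fun s => ?_⟩
  · refine (hleft (0, s) (by simp [a])).trans (Path.trans_apply_of_eq_half _ _ ?_)
    change (((0 : I) : ℝ) + s) / 2 = s / 2
    simp
  · refine (hleft (r, 1) (by simp [a])).trans (Path.trans_apply_of_eq_half_add _ _ ?_)
    change ((r : ℝ) + (1 : I)) / 2 = (r + 1) / 2
    simp
  · refine (hright (r, 0) (by simp [b])).trans (Path.trans_apply_of_eq_half _ _ ?_)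
    change ((r : ℝ) + (0 : I)) / 2 = r / 2
    simp
  · refine (hright (1, s) (by simp [b])).trans (Path.trans_apply_of_eq_half_add _ _ ?_)
    change (((1 : I) : ℝ) + s) / 2 = (s + 1) / 2
    simp [add_comm]


/-! ### The proper homotopy -/

namespace TopGraph

variable {X V E : Type*} [TopologicalSpace X] {G : TopGraph X V E}

theorem weaklyLocallyCompactSpace (G : TopGraph X V E) : WeaklyLocallyCompactSpace X where
  exists_compact_mem_nhds x := by
    obtain ⟨U, hU, hfin⟩ := G.locallyFinite_edge x
    refine ⟨⋃ e ∈ {e | (range (G.edge e) ∩ U).Nonempty}, range (G.edge e),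
      hfin.isCompact_biUnion fun e _ => isCompact_range (G.edge e).continuous,
      Filter.mem_of_superset hU fun y hy => ?_⟩
    obtain ⟨e, s, rfl⟩ := G.exists_edge y
    exact mem_biUnion (x := e) ⟨_, ⟨s, rfl⟩, hy⟩ ⟨s, rfl⟩

/-- A connected set which contains a vertex outside `S` and avoids the midpoints of all edges at
vertices in `S` stays away from every set which only meets edges with both ends in `S`. -/
theorem disjoint_of_avoid {S : Set V} {C K : Set X} (hC : _root_.IsPreconnected C)
    (hCM : C ⊆ G.Avoid {e | G.src e ∈ S ∨ G.tgt e ∈ S})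
    (hK : ∀ e s, G.edge e s ∈ K → G.src e ∈ S ∧ G.tgt e ∈ S) {v : V} (hv : v ∉ S)
    (hvC : G.pt v ∈ C) : Disjoint C K := by
  have hh : (0 : ℝ) < 1 / 2 := by norm_num
  have hh1 : (1 / 2 : ℝ) ≤ 1 := by norm_num
  let D : Set X := ⋃ v ∈ S, G.star v (1 / 2)
  let O : Set X := (⋃ v ∈ Sᶜ, G.star v (1 / 2)) ∪
    ⋃ e ∈ {e | G.src e ∈ S ∨ G.tgt e ∈ S}ᶜ, G.edge e '' Ioo 0 1
  have hD : IsOpen D := isOpen_biUnion fun v _ => G.isOpen_star hh hh1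
  have hO : IsOpen O := (isOpen_biUnion fun v _ => G.isOpen_star hh hh1).union
    (isOpen_biUnion fun e _ => G.isOpen_edge_image e isOpen_Ioo subset_rfl)
  have hDO : Disjoint D O := by
    rw [disjoint_left]
    intro x hx hx'
    obtain ⟨e, s, rfl⟩ := G.exists_edge x
    obtain ⟨u, hu, hxu⟩ := mem_iUnion₂.1 hx
    rw [edge_mem_star G hh hh1] at hxu
    rcases hx' with hx' | hx'
    · obtain ⟨w, hw, hxw⟩ := mem_iUnion₂.1 hx'
      rw [edge_mem_star G hh hh1] at hxw
      rcases hxu with ⟨rfl, h⟩ | ⟨rfl, h⟩ <;> rcases hxw with ⟨rfl, h'⟩ | ⟨rfl, h'⟩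
      · exact hw hu
      · linarith
      · linarith
      · exact hw hu
    · obtain ⟨e', he', s', hs', h⟩ := mem_iUnion₂.1 hx'
      obtain ⟨rfl, -⟩ := G.edge_inj _ _ _ _ hs'.1 hs'.2 h
      rcases hxu with ⟨rfl, -⟩ | ⟨rfl, -⟩
      exacts [he' (.inl hu), he' (.inr hu)]
  have hstar : ∀ u, ∀ x ∈ G.star u (1 / 2), x ∈ D ∪ O := by
    intro u x hx
    by_cases hu : u ∈ S
    · exact .inl (mem_biUnion hu hx)
    · exact .inr (.inl (mem_biUnion (s := Sᶜ) hu hx))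
  have hcov : C ⊆ D ∪ O := by
    intro x hx
    have hx' := hCM hx
    obtain ⟨e, s, rfl⟩ := G.exists_edge x
    rcases lt_trichotomy (s : ℝ) (1 / 2) with h | h | h
    · exact hstar _ _ ((edge_mem_star G hh hh1 e s).2 (.inl ⟨rfl, h⟩))
    · have hs : s = half := Subtype.ext h
      refine .inr (.inr (mem_biUnion (x := e) (fun he => edge_mem_avoid.1 hx' he hs)
        ⟨s, ?_, rfl⟩))
      rw [hs]
      exact ⟨half_pos', half_lt_one'⟩
    · exact hstar _ _ ((edge_mem_star G hh hh1 e s).2 (.inr ⟨rfl, by linarith⟩))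
  have hCO : C ⊆ O := hC.subset_right_of_subset_union hD hO hDO hcov
    ⟨_, hvC, .inl (mem_biUnion (s := Sᶜ) hv (G.pt_mem_star v hh))⟩
  rw [disjoint_left]
  intro x hxC hxK
  refine disjoint_left.1 hDO ?_ (hCO hxC)
  have hx' := hCM hxC
  obtain ⟨e, s, rfl⟩ := G.exists_edge x
  obtain ⟨h1, h2⟩ := hK e s hxK
  rcases lt_trichotomy (s : ℝ) (1 / 2) with h | h | h
  · exact mem_biUnion h1 ((edge_mem_star G hh hh1 e s).2 (.inl ⟨rfl, h⟩))
  · exact absurd (Subtype.ext h) (edge_mem_avoid.1 hx' (.inl h1))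
  · exact mem_biUnion h2 ((edge_mem_star G hh hh1 e s).2 (.inr ⟨rfl, by linarith⟩))

/-- The square spanned by an edge, its image and the tracks of its ends can be filled without
crossing any midpoint that is not on its boundary. -/
theorem exists_edge_square [T2Space X] {f : C(X, X)} {τ : ∀ x, Path.Homotopic.Quotient x (f x)}
    (hτ : ∀ x y (q : Path.Homotopic.Quotient x y), q.trans (τ y) = (τ x).trans (q.map f))
    {T : ∀ v, Path (G.pt v) (f (G.pt v))} (hT : ∀ v, .mk (T v) = τ (G.pt v)) (e : E) :
    ∃ g : C(I × I, X), (∀ s, g (0, s) = G.edge e s) ∧ (∀ r, g (r, 1) = T (G.tgt e) r) ∧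
      (∀ r, g (r, 0) = T (G.src e) r) ∧ (∀ s, g (1, s) = f (G.edge e s)) ∧
      ∀ M : Set E, e ∉ M → (∀ r, T (G.src e) r ∈ G.Avoid M) → (∀ r, T (G.tgt e) r ∈ G.Avoid M) →
        (∀ s, f (G.edge e s) ∈ G.Avoid M) → ∀ z, g z ∈ G.Avoid M := by
  let N : Set E := {d | d ≠ e ∧ (∀ r, T (G.src e) r ≠ G.edge d half) ∧
    (∀ r, T (G.tgt e) r ≠ G.edge d half) ∧ ∀ s, f (G.edge e s) ≠ G.edge d half}
  have h1 : ∀ s, G.edge e s ∈ G.Avoid N := fun s => edge_mem_avoid.2 fun h => absurd rfl h.1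
  have h2 : ∀ r, T (G.src e) r ∈ G.Avoid N := fun r d hd => hd.2.1 r
  have h3 : ∀ r, T (G.tgt e) r ∈ G.Avoid N := fun r d hd => hd.2.2.1 r
  have h4 : ∀ s, (G.edge e).map f.continuous s ∈ G.Avoid N := fun s d hd => hd.2.2.2 s
  have hhom : (((G.edge e).inSubtype h1).trans ((T (G.tgt e)).inSubtype h3)).Homotopic
      (((T (G.src e)).inSubtype h2).trans (((G.edge e).map f.continuous).inSubtype h4)) := by
    rw [← Path.Homotopic.Quotient.eq]
    refine ofSubtype_injective (G := G) ?_
    rw [Path.Homotopic.Quotient.mk_trans, Path.Homotopic.Quotient.mk_trans,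
      Path.Homotopic.Quotient.ofSubtype_trans, Path.Homotopic.Quotient.ofSubtype_trans,
      Path.Homotopic.Quotient.ofSubtype_mk_inSubtype,
      Path.Homotopic.Quotient.ofSubtype_mk_inSubtype,
      Path.Homotopic.Quotient.ofSubtype_mk_inSubtype,
      Path.Homotopic.Quotient.ofSubtype_mk_inSubtype, hT, hT]
    exact hτ _ _ _
  obtain ⟨g, g1, g2, g3, g4⟩ := hhom.exists_square
  refine ⟨⟨fun z => (g z : X), by fun_prop⟩, fun s => congrArg Subtype.val (g1 s),
    fun r => congrArg Subtype.val (g2 r), fun r => congrArg Subtype.val (g3 r),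
    fun s => congrArg Subtype.val (g4 s), fun M he hs ht hf z => ?_⟩
  have hMN : M ⊆ N := fun d hd => ⟨fun h => he (h ▸ hd), fun r => hs r d hd, fun r => ht r d hd,
    fun s => hf s d hd⟩
  exact avoid_anti hMN (g z).2

/-- If tracks `T v` from the vertices to their images are natural up to homotopy, and all but
finitely many of them avoid any given midpoint, then the proper map `f` is properly homotopic to the
identity. -/
theorem properlyHomotopic_id_of_tracks [T2Space X] {f : C(X, X)} (hf : IsProperMap f)
    {τ : ∀ x, Path.Homotopic.Quotient x (f x)}
    (hτ : ∀ x y (q : Path.Homotopic.Quotient x y), q.trans (τ y) = (τ x).trans (q.map f))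
    {T : ∀ v, Path (G.pt v) (f (G.pt v))} (hT : ∀ v, .mk (T v) = τ (G.pt v))
    (hfin : ∀ M : Set E, M.Finite → {v | ¬ ∀ r, T v r ∈ G.Avoid M}.Finite) :
    ProperlyHomotopic f (ContinuousMap.id X) := by
  choose g g0 gt gs g1 gM using exists_edge_square (G := G) hτ hT
  obtain ⟨H, hH⟩ := G.exists_glue g (fun v r => T v r) gs gt
  have hH0 : ∀ x, H (0, x) = x := fun x => by
    obtain ⟨e, s, rfl⟩ := G.exists_edge x
    rw [hH, g0]
  have hH1 : ∀ x, H (1, x) = f x := fun x => by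
    obtain ⟨e, s, rfl⟩ := G.exists_edge x
    rw [hH, g1]
  refine ProperlyHomotopic.symm ⟨⟨H, hH0, hH1⟩, ?_⟩
  have := G.weaklyLocallyCompactSpace
  refine isProperMap_iff_isCompact_preimage.2 ⟨H.continuous, fun K hK => ?_⟩
  change IsCompact (H ⁻¹' K)
  -- the ends `S` of the edges meeting `K`, and the edges `M` at them
  have hE := G.finite_meets_compact hK
  let S : Set V := ⋃ e ∈ {e | (range (G.edge e) ∩ K).Nonempty}, {G.src e, G.tgt e}
  have hS : S.Finite := hE.biUnion fun e _ => toFinite _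
  have hedges : ∀ S : Set V, S.Finite → {e | G.src e ∈ S ∨ G.tgt e ∈ S}.Finite := by
    intro S hS
    refine (hS.biUnion fun v _ => G.finite_star v).subset ?_
    rintro e (h | h)
    exacts [mem_biUnion h (.inl rfl), mem_biUnion h (.inr rfl)]
  let M : Set E := {e | G.src e ∈ S ∨ G.tgt e ∈ S}
  have hM : M.Finite := hedges S hS
  let W : Set V := {v | ¬ ∀ r, T v r ∈ G.Avoid M}
  have hW : W.Finite := hfin M hM
  -- away from the finite set `B` of edges the homotopy does not meet `K`
  let B : Set E := M ∪ {e | G.src e ∈ W ∨ G.tgt e ∈ W} ∪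
    {e | (range (G.edge e) ∩ f ⁻¹' ((fun e => G.edge e half) '' M)).Nonempty}
  have hB : B.Finite := (hM.union (hedges W hW)).union
    (G.finite_meets_compact (hf.isCompact_preimage (G.isCompact_mids hM)))
  have hgood : ∀ e ∉ B, ∀ z, g e z ∉ K := by
    intro e he z hz
    simp only [B, mem_union, not_or] at he
    obtain ⟨⟨heM, heW⟩, hef⟩ := he
    have hav : ∀ z, g e z ∈ G.Avoid M := by
      refine gM e M heM ?_ ?_ ?_
      · by_contra h
        exact heW (.inl h)
      · by_contra h
        exact heW (.inr h)
      · intro s d hd h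
        exact hef ⟨_, ⟨s, rfl⟩, d, hd, h.symm⟩
    refine disjoint_left.1 (disjoint_of_avoid (G := G) (S := S) (C := range (g e))
      (isPreconnected_range (g e).continuous) ?_ (fun d s hs => ?_) (v := G.src e)
      (fun h => heM (.inl h)) ⟨(0, 0), ?_⟩) ⟨z, rfl⟩ hz
    · rintro _ ⟨z, rfl⟩
      exact hav z
    · have hd : d ∈ {e | (range (G.edge e) ∩ K).Nonempty} := ⟨_, ⟨s, rfl⟩, hs⟩
      exact ⟨mem_biUnion hd (.inl rfl), mem_biUnion hd (.inr rfl)⟩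
    · rw [g0, Path.source]
  refine (isCompact_univ.prod (hB.isCompact_biUnion fun e _ =>
    isCompact_range (G.edge e).continuous)).of_isClosed_subset
    (hK.isClosed.preimage H.continuous) ?_
  rintro ⟨r, x⟩ hx
  refine ⟨trivial, ?_⟩
  obtain ⟨e, s, rfl⟩ := G.exists_edge x
  refine mem_biUnion (x := e) ?_ ⟨s, rfl⟩
  by_contra he
  rw [mem_preimage, hH] at hx
  exact hgood e he _ hx

end TopGraph

/-- A proper self-map of a core graph that induces the identity in `Out(π₁)` is properly homotopic
to the identity. -/
theorem IsCoreGraph.properlyHomotopic_id {X : Type*} [TopologicalSpace X]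
    [Topology.CWComplex (Set.univ : Set X)] [LocallyFiniteConnectedGraph X] (hX : IsCoreGraph X)
    {x₀ : X} {f : C(X, X)} (hf : IsProperMap f) (hf' : InducesIdentityInOut x₀ f) :
    ProperlyHomotopic f (ContinuousMap.id X) := by
  obtain ⟨G, hG⟩ := hX.exists_topGraph_walk
  obtain ⟨τ, hτ⟩ := hf'.exists_track
  choose T hT hTM using fun v => TopGraph.exists_tight_path (G := G) (τ (G.pt v))
  refine TopGraph.properlyHomotopic_id_of_tracks hf hτ hT fun M hM => ?_
  refine (TopGraph.finite_setOf_track_not_avoid hG hf hτ hM).subset fun v hv => ?_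
  intro hy c hc
  exact hv (hTM v M hy c hc)

theorem mainTheorem3 {X : Type*} [TopologicalSpace X] [Topology.CWComplex (Set.univ : Set X)]
    [LocallyFiniteConnectedGraph X] (hX : IsCoreGraph X) (x₀ : X) :
    (∀ f : C(X, X), IsProperMap f → InducesIdentityInOut x₀ f →
      ProperlyHomotopic f (ContinuousMap.id X)) ∧
    Function.Injective (Psi x₀ : Maps X →* Out (FundamentalGroup X x₀)) := by
  refine ⟨fun f hf hf' => hX.properlyHomotopic_id hf hf', ?_⟩
  rw [injective_iff_map_eq_one]
  rintro ⟨f⟩ h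
  obtain ⟨c, hc⟩ := (QuotientGroup.eq_one_iff (inducedAut x₀ f)).1 h
  refine Quotient.sound (hX.properlyHomotopic_id f.2.1 ⟨c, ?_⟩)
  ext γ
  exact (DFunLike.congr_fun hc γ).symm
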